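/- \textbf{Setting.} Let $Var$ be a countably infinite set of quantum variables, each of type Boolean, with state space $\mathcal H_q=\ell^2(\{0,1\})$, or integer, with $\mathcal H_q=\ell^2(\mathbb Z)$. The state space of a finite sequence $\bar q$ of distinct variables is $\mathcal H_{\bar q}=\bigotimes_i\mathcal H_{q_i}$, and $\mathcal H_{all}=\bigotimes_{q}\mathcal H_q$ is the Hilbert space with an orthonormal basis of product vectors $\bigotimes_q|x_q\rangle$, where $x$ ranges over a nonempty set of assignments of computational basis labels to the variables that is closed under changing finitely many values (for instance all assignments, or the countably many assignments that are $0$ at all but finitely many variables). An operator on $\mathcal H_{\bar q}$ is identified with its cylinder extension to $\mathcal H_{all}$. All operators are bounded, $\sqsubseteq$ is the L\"owner order, $\mathcal P(\mathcal H_{all})$ is the set of quantum predicates ($0\sqsubseteq P\sqsubseteq I$), and $\mathcal D^-(\mathcal H_{all})$ is the set of partial density operators (positive, trace at most $1$). Programs are generated by $$S::=\mathbf{skip}\mid q:=0\mid \bar q:=U\bar q\mid S_1;S_2\mid \mathbf{measure}\ M[\bar q]:\bar S\mid \mathbf{while}\ M[\bar q]=1\ \mathbf{do}\ S,$$ where $U^\dagger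 U=I$ and $M=\{M_m\}$ satisfies $\sum_m M_m^\dagger M_m=I$ (for loops, $M=\{M_0,M_1\}$). Infinite sums in the definition of measurements and in preconditions converge in the strong operator topology. \textbf{Semantics.} With $E$ the empty program, and $E;S=S$, the transitions are: $\langle\mathbf{skip},\rho\rangle\to\langle E,\rho\rangle$; $\langle q:=0,\rho\rangle\to\langle E,\sum_n|0\rangle_q\langle n|\rho|n\rangle_q\langle 0|\rangle$; $\langle\bar q:=U\bar q,\rho\rangle\to\langle E,U\rho U^\dagger\rangle$; $\langle S_1;S_2,\rho\rangle\to\langle S_1';S_2,\rho'\rangle$ whenever $\langle S_1,\rho\rangle\to\langle S_1',\rho'\rangle$; $\langle\mathbf{measure}\ M[\bar q]:\bar S,\rho\rangle\to\langle S_m,M_m\rho M_m^\dagger\rangle$ for each outcome $m$; $\langle\mathbf{while},\rho\rangle\to\langle E,M_0\rho M_0^\dagger\rangle$ and $\langle\mathbf{while},\rho\rangle\to\langle S;\mathbf{while},M_1\rho M_1^\dagger\rangle$, where $\mathbf{while}$ abbreviates $\mathbf{while}\ M[\bar q]=1\ \mathbf{do}\ S$. Put $[|S|](\rho)=\sum\{|\rho':\langle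 S,\rho\rangle\to^*\langle E,\rho'\rangle|\}$, a multiset sum with one term for every terminating computation. Write $\models_{tot}\{P\}S\{Q\}$ if $tr(P\rho)\le tr(Q[|S|](\rho))$ for all $\rho\in\mathcal D^-(\mathcal H_{all})$. \textbf{Proof system $qTD$.} All pre- and postconditions are in $\mathcal P(\mathcal H_{all})$. Axioms: $\{P\}\mathbf{skip}\{P\}$; $\{\sum_n|n\rangle_q\langle0|P|0\rangle_q\langle n|\}\,q:=0\,\{P\}$ ($n$ ranges over the basis labels of the type of $q$); $\{U^\dagger PU\}\,\bar q:=U\bar q\,\{P\}$. Rules: from $\{P\}S_1\{Q\}$ and $\{Q\}S_2\{R\}$ infer $\{P\}S_1;S_2\{R\}$; from $\{P_m\}S_m\{Q\}$ for all $m$ infer $\{\sum_mM_m^\dagger P_mM_m\}\,\mathbf{measure}\ M[\bar q]:\bar S\,\{Q\}$; from $P\sqsubseteq P'$, $\{P'\}S\{Q'\}$ and $Q'\sqsubseteq Q$ infer $\{P\}S\{Q\}$; and (Loop Total) from $\{Q\}S\{M_0^\dagger PM_0+M_1^\dagger QM_1\}$, provided that for every $\epsilon>0$ there is an $(M_1^\dagger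 QM_1,\epsilon)$-bound function of the loop, infer $\{M_0^\dagger PM_0+M_1^\dagger QM_1\}\,\mathbf{while}\ M[\bar q]=1\ \mathbf{do}\ S\,\{P\}$. Here $t:\mathcal D^-(\mathcal H_{all})\to\mathbb N$ is a $(P,\epsilon)$-bound function of the loop if, for all $\rho\in\mathcal D^-(\mathcal H_{all})$, $t([|S|](M_1\rho M_1^\dagger))\le t(\rho)$, with strict inequality whenever $tr(P\rho)\ge\epsilon$. The conditions $\sqsubseteq$ and the existence of bound functions are side conditions that only have to be true (relative completeness). Write $\vdash_{qTD}$ for derivability. \textbf{Theorem (Completeness of $qTD$ for total correctness).} For every quantum program $S$ and all quantum predicates $P,Q\in\mathcal P(\mathcal H_{all})$, $\models_{tot}\{P\}S\{Q\}$ implies $\vdash_{qTD}\{P\}S\{Q\}$. -/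

import Mathlib

/-! Quantum while-programs over Boolean and integer variables: Hilbert spaces, syntax,
operational and denotational semantics, total correctness, and the proof system `qTD`. -/

namespace QHoare

/-- The two basic types of quantum variables. -/
inductive QType where
  | boolean
  | integer

/-- Labels of the computational basis of the Hilbert space denoted by a type:
`|0⟩, |1⟩` for Boolean and `|n⟩`, `n ∈ ℤ`, for integer. -/
def Val : QType → Type
  | .boolean => Fin 2
  | .integer => ℤ

/-- The label of the basis vector `|0⟩`. -/
def Val.zero : (t : QType) → Val t
  | .boolean => (0 : Fin 2)
  | .integer => (0 : ℤ)

/-- The Hilbert space with orthonormal basis indexed by `ι`: square summable families. -/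
abbrev L2 (ι : Type) : Type := lp (fun _ : ι => ℂ) 2

open Classical in
/-- The basis vector `|i⟩`. -/
noncomputable def ket {ι : Type} (i : ι) : L2 ι := lp.single 2 i (1 : ℂ)

/-- The operator `|i⟩⟨j|`. -/
noncomputable def ketbra {ι : Type} (i j : ι) : L2 ι →L[ℂ] L2 ι :=
  InnerProductSpace.rankOne ℂ (ket i) (ket j)

/-- The trace `∑ᵢ ⟨i|T|i⟩`. It is only used for trace class operators, where the value does not
depend on the orthonormal basis. -/
noncomputable def tr {ι : Type} (T : L2 ι →L[ℂ] L2 ι) : ℂ :=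
  ∑' i, inner ℂ (ket i) (T (ket i))

/-- Partial density operators: positive operators with a convergent trace that is at most `1`.
(For a positive operator, convergence in one orthonormal basis implies convergence in all.) -/
def IsPartialDensity {ι : Type} (ρ : L2 ι →L[ℂ] L2 ι) : Prop :=
  0 ≤ ρ ∧ Summable (fun i => inner ℂ (ket i) (ρ (ket i))) ∧ (tr ρ).re ≤ 1

/-- `T = ∑ᵢ Aᵢ` with convergence in the strong operator topology. -/
def IsStrongSum {κ ι : Type} (A : κ → (L2 ι →L[ℂ] L2 ι)) (T : L2 ι →L[ℂ] L2 ι) : Prop :=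
  ∀ ψ, HasSum (fun k => A k ψ) (T ψ)

section Spaces

variable {Var : Type} (typ : Var → QType)

/-- Assignments of a basis label to every variable of the register `r = r₀, …, rₙ₋₁`
of distinct variables. -/
abbrev RegVal {n : ℕ} (r : Fin n ↪ Var) : Type := ∀ i, Val (typ (r i))

/-- The state space of a register: the tensor product of the spaces of its variables, that is, the
Hilbert space with the products of basis vectors as an orthonormal basis. -/
abbrev HReg {n : ℕ} (r : Fin n ↪ Var) : Type := L2 (RegVal typ r)

/-- A family of product basis vectors `⨂_q |x_q⟩` of the tensor product over all variables, given
by the assignments `x`; it is closed under changing finitely many coordinates. The family of all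
assignments, and the countable family of those that are `0` at all but finitely many variables,
are examples. -/
structure GlobalBasis where
  carrier : Set (∀ q, Val (typ q))
  nonempty : carrier.Nonempty
  closed : ∀ x ∈ carrier, ∀ y : (∀ q, Val (typ q)), {q | x q ≠ y q}.Finite → y ∈ carrier

variable {typ}

/-- The state space of all variables, with orthonormal basis `B`. -/
abbrev HAll (B : GlobalBasis typ) : Type := L2 B.carrier

/-- Bounded operators on the state space of all variables. -/
abbrev Op (B : GlobalBasis typ) : Type := HAll B →L[ℂ] HAll B

open Classical in
/-- The assignment `x` with the values at the register `r` replaced by `v`. -/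
noncomputable def overwriteFun {n : ℕ} (r : Fin n ↪ Var) (x : ∀ q, Val (typ q))
    (v : RegVal typ r) : ∀ q, Val (typ q) :=
  fun q => if h : ∃ i, r i = q then h.choose_spec ▸ v h.choose else x q

theorem overwriteFun_apply {n : ℕ} (r : Fin n ↪ Var) (x : ∀ q, Val (typ q))
    (v : RegVal typ r) (i : Fin n) : overwriteFun r x v (r i) = v i := by
  have h : ∃ j, r j = r i := ⟨i, rfl⟩
  have key : ∀ (j : Fin n) (hj : r j = r i), (hj ▸ v j : Val (typ (r i))) = v i := by
    intro j hj
    obtain rfl := r.injective hj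
    rfl
  unfold overwriteFun
  rw [dif_pos h]
  exact key _ h.choose_spec

theorem overwriteFun_of_not {n : ℕ} (r : Fin n ↪ Var) (x : ∀ q, Val (typ q))
    (v : RegVal typ r) (q : Var) (h : ¬ ∃ i, r i = q) : overwriteFun r x v q = x q :=
  dif_neg h

/-- `overwriteFun` on the members of `B`. -/
noncomputable def overwrite {B : GlobalBasis typ} {n : ℕ} (r : Fin n ↪ Var) (x : B.carrier)
    (v : RegVal typ r) : B.carrier :=
  ⟨overwriteFun r x.1 v, B.closed x.1 x.2 _ ((Set.finite_range r).subset (by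
    intro q hq
    by_contra hn
    exact hq (overwriteFun_of_not r x.1 v q hn).symm))⟩

/-- The values of `x` at the register `r`. -/
def restrict {B : GlobalBasis typ} {n : ℕ} (r : Fin n ↪ Var) (x : B.carrier) : RegVal typ r :=
  fun i => x.1 (r i)

theorem restrict_overwrite {B : GlobalBasis typ} {n : ℕ} (r : Fin n ↪ Var) (x : B.carrier)
    (v : RegVal typ r) : restrict r (overwrite r x v) = v :=
  funext fun i => overwriteFun_apply r x.1 v i

theorem overwrite_overwrite {B : GlobalBasis typ} {n : ℕ} (r : Fin n ↪ Var) (x : B.carrier)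
    (v w : RegVal typ r) : overwrite r (overwrite r x v) w = overwrite r x w := by
  apply Subtype.ext
  funext q
  by_cases h : ∃ i, r i = q
  · obtain ⟨i, rfl⟩ := h
    exact (overwriteFun_apply r _ w i).trans (overwriteFun_apply r _ w i).symm
  · exact ((overwriteFun_of_not r _ w q h).trans (overwriteFun_of_not r _ v q h)).trans
      (overwriteFun_of_not r _ w q h).symm

theorem overwrite_restrict {B : GlobalBasis typ} {n : ℕ} (r : Fin n ↪ Var) (x : B.carrier) :
    overwrite r x (restrict r x) = x := by
  apply Subtype.ext
  funext q
  by_cases h : ∃ i, r i = q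
  · obtain ⟨i, rfl⟩ := h
    exact overwriteFun_apply r _ _ i
  · exact overwriteFun_of_not r _ _ q h

theorem overwrite_injective {B : GlobalBasis typ} {n : ℕ} (r : Fin n ↪ Var) (x : B.carrier) :
    Function.Injective (overwrite r x) := fun v w h => by
  rw [← restrict_overwrite r x v, h, restrict_overwrite]

/-- Splitting a member of `B` into its values outside and inside of the register `r`. -/
noncomputable def splitEquiv (B : GlobalBasis typ) {n : ℕ} (r : Fin n ↪ Var) :
    {y : B.carrier // restrict r y = fun _ => Val.zero _} × RegVal typ r ≃ B.carrier where
  toFun p := overwrite r p.1.1 p.2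
  invFun x := (⟨overwrite r x (fun _ => Val.zero _), restrict_overwrite r x _⟩, restrict r x)
  left_inv := by
    rintro ⟨⟨y, hy⟩, v⟩
    refine Prod.ext (Subtype.ext ?_) (restrict_overwrite r y v)
    change overwrite r (overwrite r y v) _ = y
    rw [overwrite_overwrite, ← hy, overwrite_restrict]
  right_inv x := by
    change overwrite r (overwrite r x _) _ = x
    rw [overwrite_overwrite, overwrite_restrict]

theorem summable_sq {ι : Type} (ψ : L2 ι) : Summable (fun i => ‖ψ i‖ ^ 2) := by
  simpa using (lp.memℓp ψ).summable (by norm_num)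

theorem norm_sq_eq {ι : Type} (ψ : L2 ι) : ‖ψ‖ ^ 2 = ∑' i, ‖ψ i‖ ^ 2 := by
  simpa using lp.norm_rpow_eq_tsum (p := 2) (by norm_num) ψ

theorem memℓp_of_summable_sq {ι : Type} {f : ι → ℂ} (h : Summable (fun i => ‖f i‖ ^ 2)) :
    Memℓp f 2 :=
  memℓp_gen (by simpa using h)

/-- The vector `v ↦ ψ(x[r := v])` of the state space of the register `r`. -/
noncomputable def slice {B : GlobalBasis typ} {n : ℕ} (r : Fin n ↪ Var) (ψ : HAll B)
    (x : B.carrier) : HReg typ r :=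
  ⟨fun v => ψ (overwrite r x v),
    memℓp_of_summable_sq ((summable_sq ψ).comp_injective (overwrite_injective r x))⟩

theorem slice_overwrite {B : GlobalBasis typ} {n : ℕ} (r : Fin n ↪ Var) (ψ : HAll B)
    (x : B.carrier) (v : RegVal typ r) : slice r ψ (overwrite r x v) = slice r ψ x := by
  apply lp.ext
  funext w
  exact congrArg ψ (overwrite_overwrite r x v w)

theorem hasSum_norm_slice_sq {B : GlobalBasis typ} {n : ℕ} (r : Fin n ↪ Var) (ψ : HAll B) :
    HasSum (fun y : {y : B.carrier // restrict r y = fun _ => Val.zero _} =>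
      ‖slice r ψ y.1‖ ^ 2) (‖ψ‖ ^ 2) := by
  have h : HasSum (fun p => ‖ψ (splitEquiv B r p)‖ ^ 2) (‖ψ‖ ^ 2) := by
    rw [norm_sq_eq ψ]
    exact (splitEquiv B r).hasSum_iff.2 (summable_sq ψ).hasSum
  refine h.prod_fiberwise fun y => ?_
  rw [norm_sq_eq]
  exact (summable_sq (slice r ψ y.1)).hasSum

theorem summable_of_fibers {X Y V : Type} (e : Y × V ≃ X) (f : X → ℝ) (hf : ∀ x, 0 ≤ f x)
    (g : Y → V → ℝ) (he : ∀ y v, f (e (y, v)) = g y v) (hg : ∀ y, Summable (g y))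
    (b : Y → ℝ) (hb : ∀ y, ∑' v, g y v ≤ b y) (C : ℝ) (hC : HasSum b C) :
    Summable f ∧ ∑' x, f x ≤ C := by
  have g0 : ∀ y v, 0 ≤ g y v := fun y v => he y v ▸ hf _
  have h1 : Summable (fun y => ∑' v, g y v) :=
    Summable.of_nonneg_of_le (fun y => tsum_nonneg (g0 y)) hb hC.summable
  have h2 : Summable (fun p : Y × V => f (e p)) :=
    (summable_prod_of_nonneg fun p => hf _).2
      ⟨fun y => (hg y).congr fun v => (he y v).symm, h1.congr fun y => tsum_congr fun v => (he y v).symm⟩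
  refine ⟨e.summable_iff.1 h2, ?_⟩
  rw [← e.tsum_eq, h2.tsum_prod, ← hC.tsum_eq]
  simp only [he]
  exact h1.tsum_le_tsum hb hC.summable

theorem summable_cyl {B : GlobalBasis typ} {n : ℕ} (r : Fin n ↪ Var)
    (A : HReg typ r →L[ℂ] HReg typ r) (ψ : HAll B) :
    Summable (fun x : B.carrier => ‖A (slice r ψ x) (restrict r x)‖ ^ 2) ∧
      ∑' x : B.carrier, ‖A (slice r ψ x) (restrict r x)‖ ^ 2 ≤ ‖A‖ ^ 2 * ‖ψ‖ ^ 2 := by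
  refine summable_of_fibers (splitEquiv B r) _ (fun x => sq_nonneg _)
    (fun y v => ‖A (slice r ψ y.1) v‖ ^ 2) ?_ (fun y => summable_sq _)
    (fun y => ‖A‖ ^ 2 * ‖slice r ψ y.1‖ ^ 2) ?_ _
    ((hasSum_norm_slice_sq r ψ).mul_left (‖A‖ ^ 2))
  · intro y v
    have h1 : slice r ψ (splitEquiv B r (y, v)) = slice r ψ y.1 := slice_overwrite r ψ y.1 v
    have h2 : restrict r (splitEquiv B r (y, v)) = v := restrict_overwrite r y.1 v
    rw [h1, h2]
  · intro y
    rw [← norm_sq_eq, ← mul_pow]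
    exact pow_le_pow_left₀ (norm_nonneg _) (A.le_opNorm _) 2

/-- The cylinder extension `A ⊗ I` of an operator `A` on the state space of the register `r`:
`((A ⊗ I) ψ)(x)` is the value at `x|r` of `A` applied to `v ↦ ψ(x[r := v])`. -/
noncomputable def cyl (B : GlobalBasis typ) {n : ℕ} (r : Fin n ↪ Var)
    (A : HReg typ r →L[ℂ] HReg typ r) : Op B :=
  LinearMap.mkContinuous
    { toFun := fun ψ => ⟨fun x => A (slice r ψ x) (restrict r x),
        memℓp_of_summable_sq (summable_cyl r A ψ).1⟩
      map_add' := fun ψ φ => by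
        apply lp.ext
        funext x
        have h : slice r (ψ + φ) x = slice r ψ x + slice r φ x := rfl
        change A (slice r (ψ + φ) x) (restrict r x) = _
        rw [h, map_add]
        rfl
      map_smul' := fun c ψ => by
        apply lp.ext
        funext x
        have h : slice r (c • ψ) x = c • slice r ψ x := rfl
        change A (slice r (c • ψ) x) (restrict r x) = _
        rw [h, map_smul]
        rfl }
    ‖A‖ (fun ψ => by
      refine le_of_sq_le_sq ?_ (by positivity)
      rw [norm_sq_eq, mul_pow]
      exact (summable_cyl r A ψ).2)

/-- The one-variable register `q`. -/
def single (q : Var) : Fin 1 ↪ Var := ⟨fun _ => q, fun _ _ _ => Subsingleton.elim _ _⟩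

/-- The operator `|m⟩_q⟨n|`, acting on the variable `q` and as the identity elsewhere. -/
noncomputable def ketbraVar (B : GlobalBasis typ) (q : Var) (m n : Val (typ q)) : Op B :=
  cyl B (single q) (ketbra (fun _ => m) (fun _ => n))

end Spaces

section Programs

variable {Var : Type} (typ : Var → QType)

/-- A measurement on the register `r` with outcomes in `κ`: `∑ₘ Mₘ† Mₘ = I`. -/
structure Measurement {n : ℕ} (r : Fin n ↪ Var) (κ : Type) where
  op : κ → (HReg typ r →L[ℂ] HReg typ r)
  complete : IsStrongSum (fun m => star (op m) * op m) 1

/-- Quantum programs. `loop r M S` is `while M[r] = 1 do S`. -/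
inductive Prog where
  | skip : Prog
  | init (q : Var) : Prog
  | unitary {n : ℕ} (r : Fin n ↪ Var) (U : HReg typ r →L[ℂ] HReg typ r) (hU : star U * U = 1) : Prog
  | seq (S₁ S₂ : Prog) : Prog
  | measure {n : ℕ} (r : Fin n ↪ Var) {κ : Type} (M : Measurement typ r κ) (S : κ → Prog) : Prog
  | loop {n : ℕ} (r : Fin n ↪ Var) (M : Measurement typ r (Fin 2)) (S : Prog) : Prog

end Programs

section Semantics

variable {Var : Type} {typ : Var → QType}

/-- `E; S = S`, where `none` stands for the empty program `E`. -/
def andThen (S₁ : Option (Prog typ)) (S₂ : Prog typ) : Prog typ :=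
  match S₁ with
  | none => S₂
  | some S => Prog.seq S S₂

/-- A configuration `⟨S, ρ⟩`; the program `none` is the empty program `E`. -/
abbrev Config (B : GlobalBasis typ) : Type 1 := Option (Prog typ) × Op B

/-- The labels of the transitions that leave a configuration `⟨S, ρ⟩`: they distinguish the
outcomes of the measurement, if the first step of `S` is one. -/
def Branch : Prog typ → Type
  | .skip => Unit
  | .init _ => Unit
  | .unitary _ _ _ => Unit
  | .seq S₁ _ => Branch S₁
  | .measure (κ := κ) _ _ _ => κ
  | .loop _ _ _ => Fin 2

/-- The state `∑ₙ |0⟩_q⟨n| ρ |n⟩_q⟨0|` after the initialization of `q`. -/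
noncomputable def initState (B : GlobalBasis typ) (q : Var) (ρ : Op B) : Op B :=
  ∑' n : Val (typ q), ketbraVar B q (Val.zero _) n * ρ * ketbraVar B q n (Val.zero _)

/-- `A ρ A†`, for the cylinder extension of `A`. -/
noncomputable def conjBy (B : GlobalBasis typ) {n : ℕ} (r : Fin n ↪ Var)
    (A : HReg typ r →L[ℂ] HReg typ r) (ρ : Op B) : Op B :=
  cyl B r A * ρ * star (cyl B r A)

/-- The transition rules: `⟨S, ρ⟩ → step S b ρ` for every label `b`. -/
noncomputable def step (B : GlobalBasis typ) : (S : Prog typ) → Branch S → Op B → Config B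
  | .skip, _, ρ => (none, ρ)
  | .init q, _, ρ => (none, initState B q ρ)
  | .unitary r U _, _, ρ => (none, conjBy B r U ρ)
  | .seq S₁ S₂, b, ρ => (some (andThen (step B S₁ b ρ).1 S₂), (step B S₁ b ρ).2)
  | .measure r M S, m, ρ => (some (S m), conjBy B r (M.op m) ρ)
  | .loop r M _, (0 : Fin 2), ρ => (none, conjBy B r (M.op 0) ρ)
  | .loop r M S, (1 : Fin 2), ρ => (some (.seq S (.loop r M S)), conjBy B r (M.op 1) ρ)

/-- The computations of exactly `n` steps from a configuration to the empty program. -/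
noncomputable def TermPath (B : GlobalBasis typ) : ℕ → Config B → Type
  | 0, (none, _) => Unit
  | 0, (some _, _) => Empty
  | _ + 1, (none, _) => Empty
  | n + 1, (some S, ρ) => Σ b : Branch S, TermPath B n (step B S b ρ)

/-- The state in which a computation terminates. -/
noncomputable def TermPath.final {B : GlobalBasis typ} : (n : ℕ) → (c : Config B) → TermPath B n c → Op B
  | 0, (none, ρ), _ => ρ
  | n + 1, (some S, ρ), ⟨b, p⟩ => TermPath.final n (step B S b ρ) p

/-- The semantic function: the sum of the final states of all terminating computations of `S`
from `ρ`, each computation being counted once (a multiset sum). -/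
noncomputable def den (B : GlobalBasis typ) (S : Prog typ) (ρ : Op B) : Op B :=
  ∑' p : (Σ n, TermPath B n (some S, ρ)), TermPath.final p.1 _ p.2

/-- Quantum predicates: Hermitian operators between `0` and `I` in the Löwner order. -/
abbrev QPred (B : GlobalBasis typ) : Type := {P : Op B // 0 ≤ P ∧ P ≤ 1}

/-- Truth of `{P} S {Q}` in the sense of total correctness. (Both traces are real.) -/
def ModelsTot {B : GlobalBasis typ} (P : QPred B) (S : Prog typ) (Q : QPred B) : Prop :=
  ∀ ρ : Op B, IsPartialDensity ρ → (tr (P.1 * ρ)).re ≤ (tr (Q.1 * den B S ρ)).re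

/-- `t` is a `(P, ε)`-bound function of the loop `while M[r] = 1 do S`. Only the values of `t` at
partial density operators matter. -/
def IsBoundFunction {B : GlobalBasis typ} (P : Op B) (ε : ℝ) {n : ℕ} (r : Fin n ↪ Var)
    (M : Measurement typ r (Fin 2)) (S : Prog typ) (t : Op B → ℕ) : Prop :=
  ∀ ρ : Op B, IsPartialDensity ρ →
    t (den B S (conjBy B r (M.op 1) ρ)) ≤ t ρ ∧
    (ε ≤ (tr (P * ρ)).re → t (den B S (conjBy B r (M.op 1) ρ)) < t ρ)

/-- Provability of `{P} S {Q}` in `qTD`. -/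
inductive ProvableTD {B : GlobalBasis typ} : QPred B → Prog typ → QPred B → Prop
  | skip (P : QPred B) : ProvableTD P .skip P
  | init (q : Var) (P P' : QPred B)
      (h : IsStrongSum (fun n : Val (typ q) =>
        ketbraVar B q n (Val.zero _) * P.1 * ketbraVar B q (Val.zero _) n) P'.1) :
      ProvableTD P' (.init q) P
  | unitary {n : ℕ} (r : Fin n ↪ Var) (U : HReg typ r →L[ℂ] HReg typ r) (hU : star U * U = 1)
      (P P' : QPred B) (h : P'.1 = star (cyl B r U) * P.1 * cyl B r U) :
      ProvableTD P' (.unitary r U hU) P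
  | seq (S₁ S₂ : Prog typ) (P Q R : QPred B)
      (h₁ : ProvableTD P S₁ Q) (h₂ : ProvableTD Q S₂ R) : ProvableTD P (.seq S₁ S₂) R
  | measure {n : ℕ} (r : Fin n ↪ Var) {κ : Type} (M : Measurement typ r κ) (S : κ → Prog typ)
      (P : κ → QPred B) (P' Q : QPred B) (hS : ∀ m, ProvableTD (P m) (S m) Q)
      (h : IsStrongSum (fun m => star (cyl B r (M.op m)) * (P m).1 * cyl B r (M.op m)) P'.1) :
      ProvableTD P' (.measure r M S) Q
  | loop {n : ℕ} (r : Fin n ↪ Var) (M : Measurement typ r (Fin 2)) (S : Prog typ)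
      (P Q R : QPred B)
      (hR : R.1 = star (cyl B r (M.op 0)) * P.1 * cyl B r (M.op 0)
        + star (cyl B r (M.op 1)) * Q.1 * cyl B r (M.op 1))
      (hS : ProvableTD Q S R)
      (ht : ∀ ε : ℝ, 0 < ε → ∃ t : Op B → ℕ,
        IsBoundFunction (star (cyl B r (M.op 1)) * Q.1 * cyl B r (M.op 1)) ε r M S t) :
      ProvableTD R (.loop r M S) P
  | order (S : Prog typ) (P P' Q Q' : QPred B) (hP : P.1 ≤ P'.1)
      (h : ProvableTD P' S Q') (hQ : Q'.1 ≤ Q.1) : ProvableTD P S Q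

end Semantics

end QHoare

/-! The proof constructs weakest preconditions. For every program `S` and predicate `Q` there is a
predicate `W` with `tr (W ρ) = tr (Q [|S|](ρ))` for all partial density operators `ρ`, and `{W} S
{Q}` is derivable (`exists_provable_isWP`, by induction on `S`). If `{P} S {Q}` is true, then `tr (P
ρ) ≤ tr (W ρ)` on all states, so `P ⊑ W`, and the order rule finishes.

The loop is the hard case. Put `W₀ = 0` and `Wₖ₊₁ = M₀† P M₀ + M₁† wp(S, Wₖ) M₁`. This sequence
increases and is bounded by `I`, hence has a strong limit `W`, which is a fixed point of the
recursion and the weakest precondition. The loop rule applies with `Q = wp(S, W)`. For the bound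
functions, let `F ρ = [|S|](M₁ ρ M₁†)`. Iterating the fixed point equation gives `tr (W ρ) = tr (Wₖ
ρ) + tr (W (Fᵏ ρ))`, so `tr (W (Fᵏ ρ))` tends to `0`, and the time at which it falls below `ε` is a
ranking (`exists_boundFunction`).

Convergence is handled by replacing `tr (Q ρ)` with `val Q ρ`, the squared Hilbert–Schmidt norm of
`√Q √ρ` in `[0, ∞]`, and `[|S|]` with sums over computations in `[0, ∞]` (`pathSum`), where all
rearrangements are free. `ofReal_tr_mul` and `den_spec` lead back to the actual traces and
semantics. -/

namespace QHoare

open scoped ENNReal ComplexOrder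
open ContinuousLinearMap

/-! ### Positive operators, their quadratic forms, and strong sums. -/

section Hilbert

variable {H : Type*} [NormedAddCommGroup H] [InnerProductSpace ℂ H]

theorem enorm_sq_eq_ofReal {E : Type*} [NormedAddCommGroup E] (ψ : E) :
    ‖ψ‖ₑ ^ 2 = ENNReal.ofReal (‖ψ‖ ^ 2) := by
  rw [ENNReal.ofReal_pow (norm_nonneg _), ofReal_norm]

/-- The expectation `⟨ψ|Q|ψ⟩` of a positive operator. -/
noncomputable def expect (Q : H →L[ℂ] H) (ψ : H) : ℝ≥0∞ :=
  ENNReal.ofReal (inner ℂ ψ (Q ψ)).re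

theorem re_inner_nonneg {Q : H →L[ℂ] H} (hQ : 0 ≤ Q) (ψ : H) : 0 ≤ (inner ℂ ψ (Q ψ)).re :=
  ((nonneg_iff_isPositive Q).1 hQ).re_inner_nonneg_right ψ

theorem inner_eq_ofReal {Q : H →L[ℂ] H} (hQ : 0 ≤ Q) (ψ : H) :
    inner ℂ ψ (Q ψ) = ((inner ℂ ψ (Q ψ)).re : ℂ) := by
  have h := ((nonneg_iff_isPositive Q).1 hQ).inner_nonneg_right ψ
  exact Complex.ext rfl (by simpa using (Complex.le_def.1 h).2.symm)

theorem expect_one (ψ : H) : expect 1 ψ = ‖ψ‖ₑ ^ 2 := by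
  rw [expect, enorm_sq_eq_ofReal, one_apply_eq_self, inner_self_eq_norm_sq_to_K]
  norm_cast

theorem expect_hasSum {κ : Type*} {A : κ → H →L[ℂ] H} (hA : ∀ k, 0 ≤ A k) {T : H →L[ℂ] H} (ψ : H)
    (h : HasSum (fun k => A k ψ) (T ψ)) : expect T ψ = ∑' k, expect (A k) ψ := by
  have h1 : HasSum (fun k => (inner ℂ ψ (A k ψ)).re) (inner ℂ ψ (T ψ)).re :=
    Complex.reCLM.hasSum ((innerSL ℂ ψ).hasSum h)
  rw [expect, ← h1.tsum_eq, ENNReal.ofReal_tsum_of_nonneg (fun k => re_inner_nonneg (hA k) ψ)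
    h1.summable]
  rfl

theorem expect_add {P Q : H →L[ℂ] H} (hP : 0 ≤ P) (hQ : 0 ≤ Q) (ψ : H) :
    expect (P + Q) ψ = expect P ψ + expect Q ψ := by
  rw [expect, add_apply, inner_add_right, Complex.add_re,
    ENNReal.ofReal_add (re_inner_nonneg hP ψ) (re_inner_nonneg hQ ψ)]
  rfl

theorem nonneg_of_hasSum {κ : Type*} {A : κ → H →L[ℂ] H} (hA : ∀ k, 0 ≤ A k) {T : H →L[ℂ] H}
    (h : ∀ ψ, HasSum (fun k => A k ψ) (T ψ)) : 0 ≤ T := by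
  rw [nonneg_iff_isPositive, isPositive_iff_complex]
  intro ψ
  have h1 : HasSum (fun k => inner ℂ ψ (A k ψ)) (inner ℂ ψ (T ψ)) := (innerSL ℂ ψ).hasSum (h ψ)
  have h2 : inner ℂ ψ (T ψ) = ((inner ℂ ψ (T ψ)).re : ℂ) := by
    have h3 : HasSum (fun k => (inner ℂ ψ (A k ψ)).im) (inner ℂ ψ (T ψ)).im :=
      Complex.imCLM.hasSum h1
    have h4 : (inner ℂ ψ (T ψ)).im = 0 := by
      rw [← h3.tsum_eq]
      refine (tsum_congr fun k => ?_).trans tsum_zero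
      rw [inner_eq_ofReal (hA k)]
      exact Complex.ofReal_im _
    exact Complex.ext rfl (by simpa using h4)
  have h5 : 0 ≤ (inner ℂ ψ (T ψ)).re :=
    (Complex.reCLM.hasSum h1).nonneg fun k => re_inner_nonneg (hA k) ψ
  have h6 : inner ℂ (T ψ) ψ = inner ℂ ψ (T ψ) := by
    rw [← inner_conj_symm, h2]
    exact Complex.conj_ofReal _
  rw [h6]
  exact ⟨h2.symm, h5⟩

variable [CompleteSpace H]

/-- The square root of a positive operator. -/
noncomputable def opSqrt (Q : H →L[ℂ] H) : H →L[ℂ] H := CFC.sqrt Q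

theorem star_opSqrt (Q : H →L[ℂ] H) : star (opSqrt Q) = opSqrt Q :=
  (IsSelfAdjoint.of_nonneg (CFC.sqrt_nonneg Q)).star_eq

theorem opSqrt_mul_self {Q : H →L[ℂ] H} (hQ : 0 ≤ Q) : opSqrt Q * opSqrt Q = Q :=
  CFC.sqrt_mul_sqrt_self Q hQ

theorem inner_star_left (A : H →L[ℂ] H) (φ ψ : H) : inner ℂ (star A φ) ψ = inner ℂ φ (A ψ) := by
  rw [star_eq_adjoint, adjoint_inner_left]

theorem inner_star_right (A : H →L[ℂ] H) (φ ψ : H) : inner ℂ φ (star A ψ) = inner ℂ (A φ) ψ := by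
  rw [star_eq_adjoint, adjoint_inner_right]

theorem expect_conj (A Q : H →L[ℂ] H) (ψ : H) :
    expect (star A * Q * A) ψ = expect Q (A ψ) := by
  simp only [expect, mul_apply_eq_comp, inner_star_right]

theorem expect_star_mul_self (A : H →L[ℂ] H) (ψ : H) : expect (star A * A) ψ = ‖A ψ‖ₑ ^ 2 := by
  rw [← expect_one, ← expect_conj, mul_one]

theorem expect_eq_enorm {Q : H →L[ℂ] H} (hQ : 0 ≤ Q) (ψ : H) :
    expect Q ψ = ‖opSqrt Q ψ‖ₑ ^ 2 := by
  rw [← expect_star_mul_self, star_opSqrt, opSqrt_mul_self hQ]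

theorem le_iff_expect {P Q : H →L[ℂ] H} (hP : 0 ≤ P) (hQ : 0 ≤ Q) :
    P ≤ Q ↔ ∀ ψ, expect P ψ ≤ expect Q ψ := by
  rw [← sub_nonneg, nonneg_iff_isPositive, isPositive_iff']
  have h1 : IsSelfAdjoint (Q - P) := (IsSelfAdjoint.of_nonneg hQ).sub (IsSelfAdjoint.of_nonneg hP)
  have h2 : ∀ ψ, 0 ≤ inner ℂ ((Q - P) ψ) ψ ↔ expect P ψ ≤ expect Q ψ := by
    intro ψ
    rw [← h1.star_eq, inner_star_left, sub_apply, inner_sub_right,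
      inner_eq_ofReal hP, inner_eq_ofReal hQ, expect, expect,
      ENNReal.ofReal_le_ofReal_iff (re_inner_nonneg hQ ψ), sub_nonneg]
    exact Complex.real_le_real
  simp only [h1, true_and, h2]

theorem expect_mono {P Q : H →L[ℂ] H} (hP : 0 ≤ P) (h : P ≤ Q) (ψ : H) :
    expect P ψ ≤ expect Q ψ :=
  (le_iff_expect hP (hP.trans h)).1 h ψ

/-- Powers of a positive contraction decrease, so `B² ⊑ B`. This upgrades convergence of quadratic
forms to convergence in norm on each vector. -/
theorem norm_sq_apply_le {B : H →L[ℂ] H} (h0 : 0 ≤ B) (h1 : B ≤ 1) (ψ : H) :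
    ‖B ψ‖ ^ 2 ≤ (inner ℂ ψ (B ψ)).re := by
  have h2 : B * B ≤ B := by
    have := CStarAlgebra.pow_antitone h0 h1 (by norm_num : 1 ≤ 2)
    simpa [pow_two] using this
  have h4 : B * B = star B * B := by rw [(IsSelfAdjoint.of_nonneg h0).star_eq]
  rw [h4] at h2
  have h3 := expect_mono (star_mul_self_nonneg B) h2 ψ
  rwa [expect_star_mul_self, enorm_sq_eq_ofReal, expect,
    ENNReal.ofReal_le_ofReal_iff (re_inner_nonneg h0 ψ)] at h3

/-- A family of positive operators whose finite sums are contractions has a strong sum. -/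
theorem exists_strong_sum {κ : Type*} (A : κ → H →L[ℂ] H) (hA : ∀ k, 0 ≤ A k)
    (hb : ∀ ψ, ∑' k, expect (A k) ψ ≤ ‖ψ‖ₑ ^ 2) :
    ∃ T : H →L[ℂ] H, (0 ≤ T ∧ T ≤ 1) ∧ ∀ ψ, HasSum (fun k => A k ψ) (T ψ) := by
  have hfin : ∀ s : Finset κ, 0 ≤ ∑ k ∈ s, A k ∧ ∑ k ∈ s, A k ≤ 1 := by
    intro s
    have h0 : 0 ≤ ∑ k ∈ s, A k := Finset.sum_nonneg fun k _ => hA k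
    refine ⟨h0, (le_iff_expect h0 zero_le_one).2 fun ψ => ?_⟩
    rw [expect_one]
    refine le_trans ?_ (hb ψ)
    refine le_trans ?_ (ENNReal.sum_le_tsum s)
    rw [expect, sum_apply, inner_sum, Complex.re_sum,
      ENNReal.ofReal_sum_of_nonneg fun k _ => re_inner_nonneg (hA k) ψ]
    rfl
  have hre : ∀ ψ, Summable fun k => (inner ℂ ψ (A k ψ)).re := by
    intro ψ
    have h1 : ∑' k, expect (A k) ψ ≠ ∞ :=
      ((hb ψ).trans_lt (ENNReal.pow_lt_top enorm_lt_top)).ne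
    have h2 := ENNReal.summable_toReal h1
    refine h2.congr fun k => ?_
    exact ENNReal.toReal_ofReal (re_inner_nonneg (hA k) ψ)
  have hsum : ∀ ψ, Summable fun k => A k ψ := by
    intro ψ
    rw [summable_iff_vanishing_norm]
    intro ε hε
    obtain ⟨s, hs⟩ := summable_iff_vanishing_norm.1 (hre ψ) (ε ^ 2) (by positivity)
    refine ⟨s, fun t ht => ?_⟩
    -- The squared norm of a finite block of the sum is at most the same block of the convergent
    -- series of quadratic forms: the Cauchy criterion carries over.
    have h1 := norm_sq_apply_le (hfin t).1 (hfin t).2 ψ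
    rw [sum_apply, inner_sum, Complex.re_sum] at h1
    exact lt_of_pow_lt_pow_left₀ 2 hε.le
      ((h1.trans (le_abs_self _)).trans_lt (hs t ht))
  let T : H →L[ℂ] H := LinearMap.mkContinuous
    { toFun := fun ψ => ∑' k, A k ψ
      map_add' := fun ψ φ => by
        simp only [map_add]
        exact (hsum ψ).tsum_add (hsum φ)
      map_smul' := fun c ψ => by
        simp only [map_smul]
        exact (hsum ψ).tsum_const_smul c } 1 (fun ψ => by
      refine le_of_tendsto (hsum ψ).hasSum.norm (Filter.Eventually.of_forall fun s => ?_)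
      have h1 := norm_sq_apply_le (hfin s).1 (hfin s).2 ψ
      rw [sum_apply] at h1
      -- With `norm_sq_apply_le` this reads `‖Sψ‖² ≤ ‖ψ‖ ‖Sψ‖` for a partial sum `S`; cancelling one
      -- factor gives the bound `1`.
      have h2 : (inner ℂ ψ (∑ k ∈ s, A k ψ)).re ≤ ‖ψ‖ * ‖∑ k ∈ s, A k ψ‖ :=
        (Complex.re_le_norm _).trans (norm_inner_le_norm _ _)
      rcases (norm_nonneg (∑ k ∈ s, A k ψ)).eq_or_lt with h3 | h3
      · rw [← h3]; positivity
      · nlinarith)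
  have hT : ∀ ψ, HasSum (fun k => A k ψ) (T ψ) := fun ψ => (hsum ψ).hasSum
  have hT0 := nonneg_of_hasSum hA hT
  refine ⟨T, ⟨hT0, (le_iff_expect hT0 zero_le_one).2 fun ψ => ?_⟩, hT⟩
  rw [expect_hasSum hA ψ (hT ψ), expect_one]
  exact hb ψ

end Hilbert

/-! ### The pairing of predicates and states in `[0, ∞]`, and Kraus families. -/

section L2

variable {ι : Type}

theorem inner_ket (i : ι) (ψ : L2 ι) : inner ℂ (ket i) ψ = ψ i := by
  classical
  unfold ket
  have h := lp.inner_single_left (𝕜 := ℂ) (G := fun _ : ι => ℂ) i (1 : ℂ) ψ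
  simp only [RCLike.inner_apply, map_one, mul_one] at h
  convert h

theorem norm_ket (i : ι) : ‖ket i‖ = 1 := by
  classical
  unfold ket
  have := lp.norm_single (E := fun _ : ι => ℂ) (p := 2) (by norm_num) i (1 : ℂ)
  rw [norm_one] at this
  convert this

theorem enorm_sq_eq_tsum (ψ : L2 ι) : ‖ψ‖ₑ ^ 2 = ∑' i, ‖inner ℂ (ket i) ψ‖ₑ ^ 2 := by
  simp only [inner_ket, enorm_sq_eq_ofReal]
  rw [norm_sq_eq, ENNReal.ofReal_tsum_of_nonneg (fun i => sq_nonneg _) (summable_sq ψ)]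

/-- The square of the Hilbert–Schmidt norm. -/
noncomputable def hsSq (A : L2 ι →L[ℂ] L2 ι) : ℝ≥0∞ := ∑' i, ‖A (ket i)‖ₑ ^ 2

/-- Both sides are the sum of the squared moduli of all matrix entries, taken in the two orders. -/
theorem hsSq_star (A : L2 ι →L[ℂ] L2 ι) : hsSq (star A) = hsSq A := by
  unfold hsSq
  simp only [enorm_sq_eq_tsum (star A _), enorm_sq_eq_tsum (A _)]
  rw [ENNReal.tsum_comm]
  refine tsum_congr fun i => tsum_congr fun j => ?_
  rw [inner_star_right, ← inner_conj_symm]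
  simp only [enorm_eq_nnnorm, RCLike.nnnorm_conj]

theorem enorm_apply_le_hsSq (A : L2 ι →L[ℂ] L2 ι) (ψ : L2 ι) :
    ‖A ψ‖ₑ ^ 2 ≤ hsSq A * ‖ψ‖ₑ ^ 2 := by
  rw [← hsSq_star, hsSq, ← ENNReal.tsum_mul_right, enorm_sq_eq_tsum]
  refine ENNReal.tsum_le_tsum fun i => ?_
  rw [← inner_star_left, ← mul_pow]
  gcongr
  simp only [enorm_eq_nnnorm, ← ENNReal.coe_mul]
  exact_mod_cast nnnorm_inner_le_nnnorm (𝕜 := ℂ) _ _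

/-- The value `tr (Q ρ)` for positive operators `Q` and `ρ`, possibly infinite. -/
noncomputable def val (Q ρ : L2 ι →L[ℂ] L2 ι) : ℝ≥0∞ := ∑' i, expect Q (opSqrt ρ (ket i))

theorem val_eq_hsSq {Q : L2 ι →L[ℂ] L2 ι} (hQ : 0 ≤ Q) (ρ : L2 ι →L[ℂ] L2 ι) :
    val Q ρ = hsSq (opSqrt Q * opSqrt ρ) := by
  unfold val hsSq
  simp only [expect_eq_enorm hQ, mul_apply_eq_comp]

/-- `√Q √ρ` and `√ρ √Q` are adjoint to each other. The symmetry makes `val`, whose definition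
involves `√ρ`, additive in the state as well. -/
theorem val_comm {Q ρ : L2 ι →L[ℂ] L2 ι} (hQ : 0 ≤ Q) (hρ : 0 ≤ ρ) : val Q ρ = val ρ Q := by
  rw [val_eq_hsSq hQ, val_eq_hsSq hρ, ← hsSq_star, star_mul, star_opSqrt, star_opSqrt]

theorem val_mono {P Q : L2 ι →L[ℂ] L2 ι} (hP : 0 ≤ P) (h : P ≤ Q) (ρ : L2 ι →L[ℂ] L2 ι) :
    val P ρ ≤ val Q ρ :=
  ENNReal.tsum_le_tsum fun _ => expect_mono hP h _

theorem val_strongSum {κ : Type} {A : κ → L2 ι →L[ℂ] L2 ι} (hA : ∀ k, 0 ≤ A k)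
    {T : L2 ι →L[ℂ] L2 ι} (h : IsStrongSum A T) (ρ : L2 ι →L[ℂ] L2 ι) :
    val T ρ = ∑' k, val (A k) ρ := by
  unfold val
  rw [ENNReal.tsum_comm]
  exact tsum_congr fun i => expect_hasSum hA _ (h _)

theorem val_add {P Q : L2 ι →L[ℂ] L2 ι} (hP : 0 ≤ P) (hQ : 0 ≤ Q) (ρ : L2 ι →L[ℂ] L2 ι) :
    val (P + Q) ρ = val P ρ + val Q ρ := by
  unfold val
  rw [← ENNReal.tsum_add]
  exact tsum_congr fun i => expect_add hP hQ _

theorem val_zero (ρ : L2 ι →L[ℂ] L2 ι) : val 0 ρ = 0 := by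
  simp [val, expect]

theorem conj_nonneg_of_nonneg {ρ : L2 ι →L[ℂ] L2 ι} (hρ : 0 ≤ ρ) (A : L2 ι →L[ℂ] L2 ι) :
    0 ≤ A * ρ * star A := by
  simpa using star_left_conjugate_nonneg hρ (star A)

/-- The square root of `A ρ A†` has no usable form. After the arguments are swapped `A` enters
through a quadratic form instead, and one more adjoint moves it to the side of `Q`. -/
theorem val_conj {Q ρ : L2 ι →L[ℂ] L2 ι} (hQ : 0 ≤ Q) (hρ : 0 ≤ ρ) (A : L2 ι →L[ℂ] L2 ι) :
    val Q (A * ρ * star A) = val (star A * Q * A) ρ := by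
  rw [val_comm hQ (conj_nonneg_of_nonneg hρ A)]
  have h1 : val (A * ρ * star A) Q = hsSq (opSqrt ρ * (star A * opSqrt Q)) := by
    unfold val hsSq
    refine tsum_congr fun i => ?_
    have := expect_conj (star A) ρ (opSqrt Q (ket i))
    rw [star_star] at this
    rw [this, expect_eq_enorm hρ]
    rfl
  rw [h1, ← hsSq_star, star_mul, star_mul, star_star, star_opSqrt, star_opSqrt]
  unfold val hsSq
  refine tsum_congr fun i => ?_
  rw [expect_conj, expect_eq_enorm hQ]
  rfl

theorem hsSq_opSqrt {ρ : L2 ι →L[ℂ] L2 ι} : hsSq (opSqrt ρ) = val 1 ρ :=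
  tsum_congr fun _ => (expect_one _).symm

theorem val_one_eq_tsum {ρ : L2 ι →L[ℂ] L2 ι} (hρ : 0 ≤ ρ) : val 1 ρ = ∑' i, expect ρ (ket i) :=
  tsum_congr fun i => by rw [expect_one, expect_eq_enorm hρ]

theorem isPartialDensity_iff {ρ : L2 ι →L[ℂ] L2 ι} :
    IsPartialDensity ρ ↔ 0 ≤ ρ ∧ val 1 ρ ≤ 1 := by
  unfold IsPartialDensity
  refine and_congr_right fun hρ => ?_
  rw [val_one_eq_tsum hρ]
  have h0 : ∀ i, 0 ≤ (inner ℂ (ket i) (ρ (ket i))).re := fun i => re_inner_nonneg hρ _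
  have hc : (fun i => inner ℂ (ket i) (ρ (ket i))) =
      fun i => (((inner ℂ (ket i) (ρ (ket i))).re : ℝ) : ℂ) :=
    funext fun i => inner_eq_ofReal hρ _
  have htr : tr ρ = ((∑' i, (inner ℂ (ket i) (ρ (ket i))).re : ℝ) : ℂ) := by
    rw [tr, hc, ← Complex.ofReal_tsum]
  rw [htr, Complex.ofReal_re, hc, Complex.summable_ofReal]
  constructor
  · rintro ⟨h1, h2⟩
    have h3 : ∑' i, expect ρ (ket i) =
        ENNReal.ofReal (∑' i, (inner ℂ (ket i) (ρ (ket i))).re) :=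
      (ENNReal.ofReal_tsum_of_nonneg h0 h1).symm
    rw [h3]
    exact ENNReal.ofReal_le_one.2 h2
  · intro h
    have h1 : Summable fun i => (inner ℂ (ket i) (ρ (ket i))).re :=
      (ENNReal.summable_toReal (h.trans_lt ENNReal.one_lt_top).ne).congr fun i =>
        ENNReal.toReal_ofReal (h0 i)
    have h3 : ∑' i, expect ρ (ket i) =
        ENNReal.ofReal (∑' i, (inner ℂ (ket i) (ρ (ket i))).re) :=
      (ENNReal.ofReal_tsum_of_nonneg h0 h1).symm
    rw [h3] at h
    exact ⟨h1, ENNReal.ofReal_le_one.1 h⟩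

theorem summable_norm_sq_of_hsSq {A : L2 ι →L[ℂ] L2 ι} (hA : hsSq A ≠ ∞) :
    Summable fun p : ι × ι => ‖inner ℂ (ket p.1) (A (ket p.2))‖ ^ 2 := by
  have h : ∑' p : ι × ι, ‖inner ℂ (ket p.1) (A (ket p.2))‖ₑ ^ 2 ≠ ∞ := by
    rw [ENNReal.tsum_prod', ENNReal.tsum_comm]
    simpa only [hsSq, enorm_sq_eq_tsum] using hA
  refine (ENNReal.summable_toReal h).congr fun p => ?_
  simp

theorem hasSum_inner_ket (φ ψ : L2 ι) :
    HasSum (fun i => inner ℂ φ (ket i) * inner ℂ (ket i) ψ) (inner ℂ φ ψ) := by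
  have h := lp.hasSum_inner (𝕜 := ℂ) φ ψ
  refine h.congr_fun ?_
  intro i
  rw [← inner_conj_symm, inner_ket, inner_ket]
  exact mul_comm _ _

/-- The trace of a product of Hilbert–Schmidt operators is invariant under cyclic permutation. -/
theorem exists_hasSum_cyclic {A T : L2 ι →L[ℂ] L2 ι} (hA : hsSq A ≠ ∞) (hT : hsSq T ≠ ∞) :
    ∃ c, HasSum (fun i => inner ℂ (ket i) ((A * T) (ket i))) c ∧
      HasSum (fun i => inner ℂ (ket i) ((T * A) (ket i))) c := by
  -- The two traces are the two iterated sums of this family, which is absolutely summable because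
  -- `|ab| ≤ |a|² + |b|²`.
  let f : ι × ι → ℂ := fun p => inner ℂ (ket p.1) (A (ket p.2)) * inner ℂ (ket p.2) (T (ket p.1))
  have hf : Summable f := by
    have h1 := summable_norm_sq_of_hsSq hA
    have h2 := (Equiv.prodComm ι ι).summable_iff.2 (summable_norm_sq_of_hsSq hT)
    refine Summable.of_norm_bounded (h1.add h2) fun p => ?_
    simp only [f, norm_mul, Function.comp_apply, Equiv.prodComm_apply, Prod.fst_swap,
      Prod.snd_swap]
    nlinarith [sq_nonneg (‖inner ℂ (ket p.1) (A (ket p.2))‖ - ‖inner ℂ (ket p.2) (T (ket p.1))‖),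
      sq_nonneg ‖inner ℂ (ket p.1) (A (ket p.2))‖, sq_nonneg ‖inner ℂ (ket p.2) (T (ket p.1))‖]
  refine ⟨∑' p, f p, hf.hasSum.prod_fiberwise fun i => ?_,
    ((Equiv.prodComm ι ι).hasSum_iff.2 hf.hasSum).prod_fiberwise fun i => ?_⟩
  · have := hasSum_inner_ket (star A (ket i)) (T (ket i))
    simp only [inner_star_left] at this
    exact this
  · have := hasSum_inner_ket (star T (ket i)) (A (ket i))
    simp only [inner_star_left] at this
    refine this.congr_fun fun j => ?_
    simp only [f, Function.comp_apply, Equiv.prodComm_apply, Prod.fst_swap, Prod.snd_swap]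
    exact mul_comm _ _

theorem hsSq_mul_ne_top (Q : L2 ι →L[ℂ] L2 ι) {T : L2 ι →L[ℂ] L2 ι} (hT : hsSq T ≠ ∞) :
    hsSq (Q * T) ≠ ∞ := by
  have h : hsSq (Q * T) ≤ ‖Q‖ₑ ^ 2 * hsSq T := by
    unfold hsSq
    rw [← ENNReal.tsum_mul_left]
    refine ENNReal.tsum_le_tsum fun i => ?_
    rw [← mul_pow]
    gcongr
    exact Q.le_opENorm _
  exact (h.trans_lt (ENNReal.mul_lt_top (ENNReal.pow_lt_top enorm_lt_top) hT.lt_top)).ne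

/-- Cyclicity is applied to the Hilbert–Schmidt operators `Q √ρ` and `√ρ`, turning `tr (Q ρ)` into
`tr (√ρ Q √ρ)`, a sum of nonnegative terms. -/
theorem ofReal_tr_mul {Q ρ : L2 ι →L[ℂ] L2 ι} (hQ : 0 ≤ Q) (hρ : IsPartialDensity ρ) :
    0 ≤ (tr (Q * ρ)).re ∧ ENNReal.ofReal (tr (Q * ρ)).re = val Q ρ := by
  obtain ⟨hρ0, hρ1⟩ := isPartialDensity_iff.1 hρ
  have hs : hsSq (opSqrt ρ) ≠ ∞ := by
    rw [hsSq_opSqrt]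
    exact (hρ1.trans_lt ENNReal.one_lt_top).ne
  obtain ⟨c, h1, h2⟩ := exists_hasSum_cyclic (hsSq_mul_ne_top Q hs) hs
  rw [mul_assoc, opSqrt_mul_self hρ0] at h1
  have h3 : tr (Q * ρ) = c := h1.tsum_eq
  have h4 : HasSum (fun i => (inner ℂ (opSqrt ρ (ket i)) (Q (opSqrt ρ (ket i)))).re) c.re := by
    refine (Complex.reCLM.hasSum h2).congr_fun fun i => ?_
    have h5 := inner_star_left (opSqrt ρ) (ket i) (Q (opSqrt ρ (ket i)))
    rw [star_opSqrt] at h5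
    rw [h5]
    rfl
  rw [h3, ← h4.tsum_eq]
  have h5 : ∀ i, 0 ≤ (inner ℂ (opSqrt ρ (ket i)) (Q (opSqrt ρ (ket i)))).re :=
    fun i => re_inner_nonneg hQ _
  exact ⟨tsum_nonneg h5, ENNReal.ofReal_tsum_of_nonneg h5 h4.summable⟩

theorem val_le_one {Q ρ : L2 ι →L[ℂ] L2 ι} (hQ : 0 ≤ Q) (hQ1 : Q ≤ 1) (hρ : IsPartialDensity ρ) :
    val Q ρ ≤ 1 :=
  (val_mono hQ hQ1 ρ).trans (isPartialDensity_iff.1 hρ).2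

/-- The operator norm of `√ρ` is at most its Hilbert–Schmidt norm. Hence families of states with
finite total trace are summable in operator norm. -/
theorem enorm_le_val_one {ρ : L2 ι →L[ℂ] L2 ι} (hρ : 0 ≤ ρ) : ‖ρ‖ₑ ≤ val 1 ρ := by
  rcases eq_or_ne (val 1 ρ) ∞ with h | h
  · simp [h]
  have hs : ∀ ψ, ‖opSqrt ρ ψ‖ ^ 2 ≤ (val 1 ρ).toReal * ‖ψ‖ ^ 2 := by
    intro ψ
    have h1 := enorm_apply_le_hsSq (opSqrt ρ) ψ
    rw [hsSq_opSqrt] at h1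
    have h2 := ENNReal.toReal_mono (ENNReal.mul_ne_top h (by simp)) h1
    simpa using h2
  have h0 : 0 ≤ (val 1 ρ).toReal := ENNReal.toReal_nonneg
  have h1 : ‖ρ‖ ≤ (val 1 ρ).toReal := by
    refine opNorm_le_bound _ h0 fun ψ => ?_
    have h2 : ρ ψ = opSqrt ρ (opSqrt ρ ψ) := by
      conv_lhs => rw [← opSqrt_mul_self hρ]
      rfl
    rw [h2]
    refine le_of_sq_le_sq ((hs _).trans ?_) (by positivity)
    rw [mul_pow, pow_two (val 1 ρ).toReal, mul_assoc]
    exact mul_le_mul_of_nonneg_left (hs ψ) h0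
  rw [← ofReal_norm]
  exact ENNReal.ofReal_le_of_le_toReal h1

theorem isPartialDensity_rankOne {ψ : L2 ι} (hψ : ‖ψ‖ ≤ 1) :
    IsPartialDensity (InnerProductSpace.rankOne ℂ ψ ψ) ∧
      ∀ Q, 0 ≤ Q → val Q (InnerProductSpace.rankOne ℂ ψ ψ) = expect Q ψ := by
  have h0 : 0 ≤ InnerProductSpace.rankOne ℂ ψ ψ :=
    (nonneg_iff_isPositive _).2 (InnerProductSpace.isPositive_rankOne_self ψ)
  have h1 : ∀ Q, 0 ≤ Q → val Q (InnerProductSpace.rankOne ℂ ψ ψ) = expect Q ψ := by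
    intro Q hQ
    rw [val_comm hQ h0, expect_eq_enorm hQ, enorm_sq_eq_tsum, val]
    refine tsum_congr fun i => ?_
    rw [← inner_star_left, star_opSqrt, expect, enorm_sq_eq_ofReal]
    congr 1
    rw [InnerProductSpace.rankOne_apply, inner_smul_right, pow_two]
    have h2 := inner_mul_symm_re_eq_norm (𝕜 := ℂ) ψ (opSqrt Q (ket i))
    rw [norm_mul, norm_inner_symm ψ] at h2
    exact h2
  refine ⟨isPartialDensity_iff.2 ⟨h0, ?_⟩, h1⟩
  rw [h1 1 zero_le_one, expect_one]
  refine pow_le_one₀ (by positivity) ?_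
  rw [← ofReal_norm]
  exact ENNReal.ofReal_le_one.2 hψ

/-- Pure states `|ψ⟩⟨ψ|` already detect the order; a general vector is normalized first. -/
theorem le_of_val_le {P Q : L2 ι →L[ℂ] L2 ι} (hP : 0 ≤ P) (hQ : 0 ≤ Q)
    (h : ∀ ρ, IsPartialDensity ρ → val P ρ ≤ val Q ρ) : P ≤ Q := by
  have h1 : ∀ ψ : L2 ι, ‖ψ‖ ≤ 1 → (inner ℂ ψ (P ψ)).re ≤ (inner ℂ ψ (Q ψ)).re := by
    intro ψ hψ
    obtain ⟨h2, h3⟩ := isPartialDensity_rankOne hψ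
    have := h _ h2
    rwa [h3 P hP, h3 Q hQ, expect, expect,
      ENNReal.ofReal_le_ofReal_iff (re_inner_nonneg hQ ψ)] at this
  refine (le_iff_expect hP hQ).2 fun ψ => ENNReal.ofReal_le_ofReal ?_
  rcases eq_or_ne ψ 0 with rfl | hψ
  · simp
  have hn : 0 < ‖ψ‖ := norm_pos_iff.2 hψ
  have h2 := h1 (((‖ψ‖⁻¹ : ℝ) : ℂ) • ψ) (by
    rw [norm_smul, Complex.norm_real, norm_inv, norm_norm, inv_mul_cancel₀ hn.ne'])
  simp only [map_smul, inner_smul_left, inner_smul_right, Complex.conj_ofReal,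
    Complex.re_ofReal_mul] at h2
  have hp : 0 < ‖ψ‖⁻¹ := inv_pos.2 hn
  exact le_of_mul_le_mul_left (le_of_mul_le_mul_left h2 hp) hp

/-- A bounded increasing sequence of positive operators has a strong limit. -/
theorem exists_strong_limit {W : ℕ → L2 ι →L[ℂ] L2 ι} (h0 : W 0 = 0) (h1 : ∀ n, W n ≤ 1)
    (hm : ∀ n, W n ≤ W (n + 1)) :
    ∃ T, (0 ≤ T ∧ T ≤ 1) ∧ (∀ ρ, val T ρ = ∑' k, val (W (k + 1) - W k) ρ) ∧
      ∀ n ρ, ∑ k ∈ Finset.range n, val (W (k + 1) - W k) ρ = val (W n) ρ := by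
  have hD : ∀ k, 0 ≤ W (k + 1) - W k := fun k => sub_nonneg.2 (hm k)
  have hW : ∀ n, 0 ≤ W n := fun n => by
    induction n with
    | zero => exact h0.ge
    | succ n ih => exact ih.trans (hm n)
  have he : ∀ n ψ, ∑ k ∈ Finset.range n, expect (W (k + 1) - W k) ψ = expect (W n) ψ := by
    intro n ψ
    induction n with
    | zero => simp [h0, expect]
    | succ n ih => rw [Finset.sum_range_succ, ih, ← expect_add (hW n) (hD n), add_sub_cancel]
  -- The limit is the strong sum of the increments, whose partial sums telescope.
  obtain ⟨T, hT, hs⟩ := exists_strong_sum (fun k => W (k + 1) - W k) hD fun ψ => by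
    rw [ENNReal.tsum_eq_iSup_nat]
    refine iSup_le fun n => ?_
    rw [he, ← expect_one]
    exact expect_mono (hW n) (h1 n) ψ
  refine ⟨T, hT, val_strongSum hD hs, fun n ρ => ?_⟩
  induction n with
  | zero => simp [h0, val_zero]
  | succ n ih => rw [Finset.sum_range_succ, ih, ← val_add (hW n) (hD n), add_sub_cancel]

/-- A family of states of total trace at most one has a sum, and expectations are additive. -/
theorem tsum_states {κ : Type} {ρ : κ → L2 ι →L[ℂ] L2 ι} (hρ : ∀ k, 0 ≤ ρ k)
    (h : ∑' k, val 1 (ρ k) ≤ 1) :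
    IsPartialDensity (∑' k, ρ k) ∧ ∀ Q, 0 ≤ Q → val Q (∑' k, ρ k) = ∑' k, val Q (ρ k) := by
  -- Without summability in operator norm the `tsum` would be the default value `0`.
  have hs : Summable ρ := by
    refine Summable.of_norm ?_
    have h1 : ∑' k, ‖ρ k‖ₑ ≠ ∞ :=
      ((ENNReal.tsum_le_tsum fun k => enorm_le_val_one (hρ k)).trans
        h |>.trans_lt ENNReal.one_lt_top).ne
    exact (ENNReal.summable_toReal h1).congr fun k => by simp
  have hstr : IsStrongSum ρ (∑' k, ρ k) := fun ψ =>
    (ContinuousLinearMap.apply ℂ (L2 ι) ψ).hasSum hs.hasSum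
  have h0 : 0 ≤ ∑' k, ρ k := nonneg_of_hasSum hρ hstr
  have h1 : ∀ Q, 0 ≤ Q → val Q (∑' k, ρ k) = ∑' k, val Q (ρ k) := by
    intro Q hQ
    rw [val_comm hQ h0, val_strongSum hρ hstr]
    exact tsum_congr fun k => val_comm (hρ k) hQ
  refine ⟨isPartialDensity_iff.2 ⟨h0, ?_⟩, h1⟩
  rwa [h1 1 zero_le_one]

/-- A family of operators with `∑ₖ Aₖ† Aₖ ≤ I`. -/
def IsKraus {κ : Type} (A : κ → L2 ι →L[ℂ] L2 ι) : Prop :=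
  ∀ ψ, ∑' k, ‖A k ψ‖ₑ ^ 2 ≤ ‖ψ‖ₑ ^ 2

theorem IsKraus.exists_strongSum {κ : Type} {A : κ → L2 ι →L[ℂ] L2 ι} (hA : IsKraus A)
    {P : κ → L2 ι →L[ℂ] L2 ι} (hP : ∀ k, 0 ≤ P k ∧ P k ≤ 1) :
    ∃ T, (0 ≤ T ∧ T ≤ 1) ∧ IsStrongSum (fun k => star (A k) * P k * A k) T := by
  refine exists_strong_sum _ (fun k => star_left_conjugate_nonneg (hP k).1 (A k)) fun ψ => ?_
  refine le_trans (ENNReal.tsum_le_tsum fun k => ?_) (hA ψ)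
  rw [expect_conj, ← expect_one]
  exact expect_mono (hP k).1 (hP k).2 _

/-- Duality between the map on predicates, `P ↦ ∑ Aₖ† Pₖ Aₖ`, and the branches `Aₖ ρ Aₖ†` of the
state. -/
theorem IsKraus.val_eq_tsum {κ : Type} {A P : κ → L2 ι →L[ℂ] L2 ι}
    (hP : ∀ k, 0 ≤ P k) {T : L2 ι →L[ℂ] L2 ι}
    (hT : IsStrongSum (fun k => star (A k) * P k * A k) T) {ρ : L2 ι →L[ℂ] L2 ι} (hρ : 0 ≤ ρ) :
    val T ρ = ∑' k, val (P k) (A k * ρ * star (A k)) := by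
  rw [val_strongSum (fun k => star_left_conjugate_nonneg (hP k) (A k)) hT]
  exact tsum_congr fun k => (val_conj (hP k) hρ (A k)).symm

theorem IsKraus.tsum_val_one_le {κ : Type} {A : κ → L2 ι →L[ℂ] L2 ι} (hA : IsKraus A)
    {ρ : L2 ι →L[ℂ] L2 ι} (hρ : IsPartialDensity ρ) :
    ∑' k, val 1 (A k * ρ * star (A k)) ≤ 1 := by
  obtain ⟨T, ⟨h0, h1⟩, hT⟩ := hA.exists_strongSum (P := fun _ => 1) fun _ => ⟨zero_le_one, le_rfl⟩
  rw [← IsKraus.val_eq_tsum (P := fun _ => 1) (fun _ => zero_le_one) hT hρ.1]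
  exact val_le_one h0 h1 hρ

theorem IsKraus.isPartialDensity {κ : Type} {A : κ → L2 ι →L[ℂ] L2 ι} (hA : IsKraus A)
    {ρ : L2 ι →L[ℂ] L2 ι} (hρ : IsPartialDensity ρ) (k : κ) :
    IsPartialDensity (A k * ρ * star (A k)) :=
  isPartialDensity_iff.2 ⟨conj_nonneg_of_nonneg hρ.1 _,
    (ENNReal.le_tsum k).trans (hA.tsum_val_one_le hρ)⟩

end L2

/-! ### Cylinder extensions, and the Kraus families of the program constructs. -/

section Cylinder

variable {Var : Type} {typ : Var → QType} {B : GlobalBasis typ} {n : ℕ} (r : Fin n ↪ Var)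

/-- The global space is an orthogonal sum of copies of the register space, one for each assignment
outside `r`; `cyl B r A` acts as `A` on every copy. Adjoints and Kraus bounds transfer copy by copy.
-/
theorem slice_cyl (A : HReg typ r →L[ℂ] HReg typ r) (ψ : HAll B) (x : B.carrier) :
    slice r (cyl B r A ψ) x = A (slice r ψ x) := by
  apply lp.ext
  funext v
  change A (slice r ψ (overwrite r x v)) (restrict r (overwrite r x v)) = _
  rw [slice_overwrite, restrict_overwrite]

theorem hasSum_inner_slice (φ ψ : HAll B) :
    HasSum (fun y : {y : B.carrier // restrict r y = fun _ => Val.zero _} =>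
      inner ℂ (slice r φ y.1) (slice r ψ y.1)) (inner ℂ φ ψ) := by
  have h : HasSum (fun p => inner ℂ (φ (splitEquiv B r p)) (ψ (splitEquiv B r p)))
      (inner ℂ φ ψ) :=
    (splitEquiv B r).hasSum_iff.2 (lp.hasSum_inner φ ψ)
  exact h.prod_fiberwise fun y => lp.hasSum_inner (slice r φ y.1) (slice r ψ y.1)

theorem star_cyl (A : HReg typ r →L[ℂ] HReg typ r) : star (cyl B r A) = cyl B r (star A) := by
  symm
  refine (eq_adjoint_iff _ _).2 ?_
  intro φ ψ
  refine (hasSum_inner_slice r _ _).unique ((hasSum_inner_slice r _ _).congr_fun fun y => ?_)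
  rw [slice_cyl, slice_cyl, inner_star_left]

theorem enorm_sq_eq_tsum_slice (ψ : HAll B) :
    ‖ψ‖ₑ ^ 2 = ∑' y : {y : B.carrier // restrict r y = fun _ => Val.zero _},
      ‖slice r ψ y.1‖ₑ ^ 2 := by
  have h := hasSum_norm_slice_sq r ψ
  simp only [enorm_sq_eq_ofReal]
  rw [← h.tsum_eq, ENNReal.ofReal_tsum_of_nonneg (fun _ => sq_nonneg _) h.summable]

theorem IsKraus.cyl {κ : Type} {A : κ → HReg typ r →L[ℂ] HReg typ r} (hA : IsKraus A) :
    IsKraus fun k => cyl B r (A k) := by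
  intro ψ
  simp only [enorm_sq_eq_tsum_slice r, slice_cyl]
  rw [ENNReal.tsum_comm]
  exact ENNReal.tsum_le_tsum fun y => hA _

theorem Measurement.isKraus {κ : Type} (M : Measurement typ r κ) : IsKraus M.op := by
  intro ψ
  rw [← expect_one, expect_hasSum (fun k => star_mul_self_nonneg (M.op k)) ψ (M.complete ψ)]
  simp only [expect_star_mul_self, le_refl]

theorem isKraus_of_isometry {ι : Type} {U : L2 ι →L[ℂ] L2 ι} (hU : star U * U = 1) :
    IsKraus fun _ : Unit => U := by
  intro ψ
  have h : ‖U ψ‖ₑ ^ 2 = ‖ψ‖ₑ ^ 2 := by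
    rw [← expect_star_mul_self, hU, expect_one]
  simp [h]

theorem star_ketbra {ι : Type} (i j : ι) : star (ketbra i j) = ketbra j i := by
  rw [star_eq_adjoint, ketbra, InnerProductSpace.adjoint_rankOne, ketbra]

/-- The label `n` as a value of the one-variable register `q`. -/
def singleVal (q : Var) (n : Val (typ q)) : RegVal typ (single q) := fun _ => n

theorem ketbraVar_eq (q : Var) (i j : Val (typ q)) :
    ketbraVar B q i j = cyl B (single q) (ketbra (singleVal q i) (singleVal q j)) := rfl

theorem star_ketbraVar (q : Var) (i j : Val (typ q)) :
    star (ketbraVar B q i j) = ketbraVar B q j i := by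
  rw [ketbraVar_eq, star_cyl, star_ketbra, ketbraVar_eq]

/-- Bessel's inequality for the basis vectors selected by `f`. -/
theorem isKraus_ketbra {ι κ : Type} (i : ι) (f : κ ↪ ι) : IsKraus fun k => ketbra i (f k) := by
  intro ψ
  have h : ∀ k, ‖ketbra i (f k) ψ‖ₑ ^ 2 = ‖inner ℂ (ket (f k)) ψ‖ₑ ^ 2 := by
    intro k
    rw [ketbra, InnerProductSpace.rankOne_apply, enorm_smul, ← ofReal_norm (ket i), norm_ket]
    simp
  simp only [h]
  rw [enorm_sq_eq_tsum ψ]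
  exact ENNReal.tsum_comp_le_tsum_of_injective f.injective _

theorem isKraus_ketbraVar (q : Var) :
    IsKraus fun n : Val (typ q) => ketbraVar B q (Val.zero _) n := by
  simp only [ketbraVar_eq]
  exact IsKraus.cyl (single q) (isKraus_ketbra (singleVal q (Val.zero _))
    ⟨singleVal q, fun _ _ h => congrFun h 0⟩)

end Cylinder

theorem tsum_unit (f : Unit → ℝ≥0∞) : ∑' b, f b = f () := by
  simp

theorem tsum_fin_two (f : Fin 2 → ℝ≥0∞) : ∑' b, f b = f 0 + f 1 := by
  simp

/-! ### Sums of nonnegative quantities over computations. -/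

section Paths

variable {Var : Type} {typ : Var → QType} {B : GlobalBasis typ}

/-- The sum of `q` over the final states of all computations of exactly `n` steps. -/
noncomputable def stepSum (q : Op B → ℝ≥0∞) (n : ℕ) (c : Config B) : ℝ≥0∞ :=
  ∑' p : TermPath B n c, q (TermPath.final n c p)

/-- The sum of `q` over the final states of all terminating computations. -/
noncomputable def pathSum (q : Op B → ℝ≥0∞) (c : Config B) : ℝ≥0∞ :=
  ∑' p : (Σ n, TermPath B n c), q (TermPath.final p.1 c p.2)

theorem pathSum_eq_tsum (q : Op B → ℝ≥0∞) (c : Config B) : pathSum q c = ∑' n, stepSum q n c :=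
  ENNReal.tsum_sigma' _

theorem stepSum_zero_none (q : Op B → ℝ≥0∞) (ρ : Op B) : stepSum q 0 (none, ρ) = q ρ :=
  tsum_unit _

theorem stepSum_zero_some (q : Op B → ℝ≥0∞) (S : Prog typ) (ρ : Op B) :
    stepSum q 0 (some S, ρ) = 0 :=
  haveI : IsEmpty (TermPath B 0 (some S, ρ)) := inferInstanceAs (IsEmpty Empty)
  tsum_empty

theorem stepSum_succ_none (q : Op B → ℝ≥0∞) (n : ℕ) (ρ : Op B) :
    stepSum q (n + 1) (none, ρ) = 0 :=
  haveI : IsEmpty (TermPath B (n + 1) (none, ρ)) := inferInstanceAs (IsEmpty Empty)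
  tsum_empty

theorem stepSum_succ_some (q : Op B → ℝ≥0∞) (n : ℕ) (S : Prog typ) (ρ : Op B) :
    stepSum q (n + 1) (some S, ρ) = ∑' b, stepSum q n (step B S b ρ) :=
  ENNReal.tsum_sigma' (β := fun b : Branch S => TermPath B n (step B S b ρ))
    (fun p => q (TermPath.final n (step B S p.1 ρ) p.2))

/-- The part of `pathSum` that comes from computations of less than `n` steps. -/
noncomputable def pathSumLT (q : Op B → ℝ≥0∞) (n : ℕ) (c : Config B) : ℝ≥0∞ :=
  ∑ k ∈ Finset.range n, stepSum q k c

theorem pathSumLT_succ_none (q : Op B → ℝ≥0∞) (n : ℕ) (ρ : Op B) :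
    pathSumLT q (n + 1) (none, ρ) = q ρ := by
  simp [pathSumLT, Finset.sum_range_succ', stepSum_succ_none, stepSum_zero_none]

theorem pathSumLT_succ_some (q : Op B → ℝ≥0∞) (n : ℕ) (S : Prog typ) (ρ : Op B) :
    pathSumLT q (n + 1) (some S, ρ) = ∑' b, pathSumLT q n (step B S b ρ) := by
  simp only [pathSumLT, Finset.sum_range_succ', stepSum_succ_some, stepSum_zero_some, add_zero]
  exact (Summable.tsum_finsetSum fun _ _ => ENNReal.summable).symm

theorem pathSumLT_le_pathSum (q : Op B → ℝ≥0∞) (n : ℕ) (c : Config B) :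
    pathSumLT q n c ≤ pathSum q c := by
  rw [pathSum_eq_tsum]
  exact ENNReal.sum_le_tsum _

theorem pathSum_le {q : Op B → ℝ≥0∞} {c : Config B} {a : ℝ≥0∞}
    (h : ∀ n, pathSumLT q n c ≤ a) : pathSum q c ≤ a := by
  rw [pathSum_eq_tsum, ENNReal.tsum_eq_iSup_nat]
  exact iSup_le h

theorem pathSumLT_mono_right (q : Op B → ℝ≥0∞) (n : ℕ) (c : Config B) :
    pathSumLT q n c ≤ pathSumLT q (n + 1) c :=
  Finset.sum_le_sum_of_subset (Finset.range_mono n.le_succ)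

theorem pathSumLT_mono {q q' : Op B → ℝ≥0∞} (h : ∀ ρ, q ρ ≤ q' ρ) (n : ℕ) (c : Config B) :
    pathSumLT q n c ≤ pathSumLT q' n c :=
  Finset.sum_le_sum fun _ _ => ENNReal.tsum_le_tsum fun _ => h _

theorem pathSum_none (q : Op B → ℝ≥0∞) (ρ : Op B) : pathSum q (none, ρ) = q ρ := by
  rw [pathSum_eq_tsum, tsum_eq_single 0, stepSum_zero_none]
  rintro (_ | n) hn
  · exact (hn rfl).elim
  · exact stepSum_succ_none q n ρ

theorem pathSum_some (q : Op B → ℝ≥0∞) (S : Prog typ) (ρ : Op B) :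
    pathSum q (some S, ρ) = ∑' b, pathSum q (step B S b ρ) := by
  simp only [pathSum_eq_tsum]
  rw [tsum_eq_zero_add' ENNReal.summable, stepSum_zero_some, zero_add, ENNReal.tsum_comm]
  exact tsum_congr fun n => stepSum_succ_some q n S ρ

/-- Sequential composition of a configuration and a program. -/
def Config.seq (c : Config B) (S : Prog typ) : Config B := (some (andThen c.1 S), c.2)

theorem pathSum_seq_some (q : Op B → ℝ≥0∞) (S₁ S₂ : Prog typ) (ρ : Op B) :
    pathSum q (some (.seq S₁ S₂), ρ) = ∑' b, pathSum q (Config.seq (step B S₁ b ρ) S₂) :=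
  pathSum_some q (.seq S₁ S₂) ρ

/-- A short computation of a sequential composition splits into two computations, each of which
obeys the same length bound. -/
theorem pathSumLT_seq_le (q : Op B → ℝ≥0∞) (S : Prog typ) (n : ℕ) (c : Config B) :
    pathSumLT q n (Config.seq c S) ≤
      pathSumLT (fun ρ => pathSumLT q n (some S, ρ)) n c := by
  induction n generalizing c with
  | zero => exact le_rfl
  | succ n ih =>
    obtain ⟨_ | S₁, ρ⟩ := c
    · rw [pathSumLT_succ_none]
      exact le_rfl
    · have h : pathSumLT q (n + 1) (Config.seq (some S₁, ρ) S) =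
          ∑' b, pathSumLT q n (Config.seq (step B S₁ b ρ) S) :=
        pathSumLT_succ_some q n (.seq S₁ S) ρ
      rw [h, pathSumLT_succ_some]
      exact ENNReal.tsum_le_tsum fun b => (ih _).trans
        (pathSumLT_mono (fun ρ => pathSumLT_mono_right q n _) n _)

/-- Conversely, computations of the two components concatenate; only the first needs a length bound
for the induction. -/
theorem pathSumLT_le_pathSum_seq (q : Op B → ℝ≥0∞) (S : Prog typ) (n : ℕ) (c : Config B) :
    pathSumLT (fun ρ => pathSum q (some S, ρ)) n c ≤ pathSum q (Config.seq c S) := by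
  induction n generalizing c with
  | zero => exact zero_le
  | succ n ih =>
    obtain ⟨_ | S₁, ρ⟩ := c
    · rw [pathSumLT_succ_none]
      exact le_rfl
    · have h : pathSum q (Config.seq (some S₁, ρ) S) =
          ∑' b, pathSum q (Config.seq (step B S₁ b ρ) S) := pathSum_seq_some q S₁ S ρ
      rw [h, pathSumLT_succ_some]
      exact ENNReal.tsum_le_tsum fun b => ih _

theorem pathSum_seq (q : Op B → ℝ≥0∞) (S₁ S₂ : Prog typ) (ρ : Op B) :
    pathSum q (some (.seq S₁ S₂), ρ) =
      pathSum (fun σ => pathSum q (some S₂, σ)) (some S₁, ρ) := by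
  refine le_antisymm (pathSum_le fun n => ?_) (pathSum_le fun n => ?_)
  · refine (pathSumLT_seq_le q S₂ n (some S₁, ρ)).trans ?_
    exact (pathSumLT_mono (fun σ => pathSumLT_le_pathSum q n _) n _).trans
      (pathSumLT_le_pathSum _ n _)
  · exact pathSumLT_le_pathSum_seq q S₂ n (some S₁, ρ)

theorem pathSum_skip (q : Op B → ℝ≥0∞) (ρ : Op B) : pathSum q (some .skip, ρ) = q ρ := by
  rw [pathSum_some, ← pathSum_none q ρ]
  exact tsum_unit _

theorem pathSum_init (q : Op B → ℝ≥0∞) (x : Var) (ρ : Op B) :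
    pathSum q (some (.init x), ρ) = q (initState B x ρ) := by
  rw [pathSum_some, ← pathSum_none q]
  exact tsum_unit _

theorem pathSum_unitary (q : Op B → ℝ≥0∞) {n : ℕ} (r : Fin n ↪ Var)
    (U : HReg typ r →L[ℂ] HReg typ r) (hU : star U * U = 1) (ρ : Op B) :
    pathSum q (some (.unitary r U hU), ρ) = q (conjBy B r U ρ) := by
  rw [pathSum_some, ← pathSum_none q]
  exact tsum_unit _

theorem pathSum_measure (q : Op B → ℝ≥0∞) {n : ℕ} (r : Fin n ↪ Var) {κ : Type}
    (M : Measurement typ r κ) (S : κ → Prog typ) (ρ : Op B) :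
    pathSum q (some (.measure r M S), ρ) =
      ∑' m, pathSum q (some (S m), conjBy B r (M.op m) ρ) :=
  pathSum_some q (.measure r M S) ρ

theorem pathSum_loop (q : Op B → ℝ≥0∞) {n : ℕ} (r : Fin n ↪ Var)
    (M : Measurement typ r (Fin 2)) (S : Prog typ) (ρ : Op B) :
    pathSum q (some (.loop r M S), ρ) = q (conjBy B r (M.op 0) ρ) +
      pathSum (fun σ => pathSum q (some (.loop r M S), σ)) (some S, conjBy B r (M.op 1) ρ) := by
  rw [← pathSum_seq, ← pathSum_none q, pathSum_some]
  exact tsum_fin_two _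

/-- The measurement of the guard costs one step, so the next round of the loop has a smaller budget.
This drives the induction in `isWP_loop_sup`. -/
theorem pathSumLT_succ_loop_le (q : Op B → ℝ≥0∞) {n : ℕ} (r : Fin n ↪ Var)
    (M : Measurement typ r (Fin 2)) (S : Prog typ) (k : ℕ) (ρ : Op B) :
    pathSumLT q (k + 1) (some (.loop r M S), ρ) ≤ q (conjBy B r (M.op 0) ρ) +
      pathSum (fun σ => pathSumLT q k (some (.loop r M S), σ))
        (some S, conjBy B r (M.op 1) ρ) := by
  have h : pathSumLT q (k + 1) (some (.loop r M S), ρ) =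
      pathSumLT q k (none, conjBy B r (M.op 0) ρ) +
        pathSumLT q k (Config.seq (some S, conjBy B r (M.op 1) ρ) (.loop r M S)) :=
    (pathSumLT_succ_some q k (.loop r M S) ρ).trans
      (tsum_fin_two _)
  rw [h]
  refine add_le_add ?_ ((pathSumLT_seq_le q _ k _).trans (pathSumLT_le_pathSum _ k _))
  exact (pathSumLT_le_pathSum q k _).trans (pathSum_none q _).le

theorem pathSum_tsum {κ : Type} (q : κ → Op B → ℝ≥0∞) (c : Config B) :
    pathSum (fun ρ => ∑' k, q k ρ) c = ∑' k, pathSum (q k) c :=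
  ENNReal.tsum_comm

theorem pathSum_mono_of_final {q q' : Op B → ℝ≥0∞} {c : Config B}
    (h : ∀ n (p : TermPath B n c), q (p.final n c) ≤ q' (p.final n c)) :
    pathSum q c ≤ pathSum q' c :=
  ENNReal.tsum_le_tsum fun p => h p.1 p.2

theorem final_induction {I : Op B → Prop} (hI : ∀ S b ρ, I ρ → I (step B S b ρ).2) (n : ℕ)
    (c : Config B) (hc : I c.2) (p : TermPath B n c) : I (p.final n c) := by
  induction n generalizing c with
  | zero =>
    obtain ⟨_ | S, ρ⟩ := c
    · exact hc
    · exact p.elim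
  | succ n ih =>
    obtain ⟨_ | S, ρ⟩ := c
    · exact p.elim
    · exact ih (step B S p.1 ρ) (hI S p.1 ρ hc) p.2

end Paths

/-! ### Preservation of partial density operators, and weakest preconditions. -/

section WeakestPreconditions

variable {Var : Type} {typ : Var → QType} {B : GlobalBasis typ}

theorem initState_spec (q : Var) {ρ : Op B} (hρ : IsPartialDensity ρ) :
    IsPartialDensity (initState B q ρ) ∧ ∀ Q, 0 ≤ Q → val Q (initState B q ρ) =
      ∑' n : Val (typ q), val Q (ketbraVar B q (Val.zero _) n * ρ *
        star (ketbraVar B q (Val.zero _) n)) := by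
  have h : initState B q ρ = ∑' n : Val (typ q), ketbraVar B q (Val.zero _) n * ρ *
      star (ketbraVar B q (Val.zero _) n) :=
    tsum_congr fun n => by rw [star_ketbraVar]
  rw [h]
  exact tsum_states (fun n => conj_nonneg_of_nonneg hρ.1 _)
    ((isKraus_ketbraVar q).tsum_val_one_le hρ)

theorem isPartialDensity_conjBy {n : ℕ} (r : Fin n ↪ Var) {κ : Type}
    {A : κ → HReg typ r →L[ℂ] HReg typ r} (hA : IsKraus A) {ρ : Op B} (hρ : IsPartialDensity ρ)
    (k : κ) : IsPartialDensity (conjBy B r (A k) ρ) :=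
  (IsKraus.cyl (B := B) r hA).isPartialDensity hρ k

theorem isPartialDensity_step (S : Prog typ) (b : Branch S) (ρ : Op B) (hρ : IsPartialDensity ρ) :
    IsPartialDensity (step B S b ρ).2 := by
  induction S with
  | skip => exact hρ
  | init q => exact (initState_spec q hρ).1
  | unitary r U hU => exact isPartialDensity_conjBy r (isKraus_of_isometry hU) hρ ()
  | seq S₁ S₂ ih₁ _ => exact ih₁ b
  | measure r M S _ => exact isPartialDensity_conjBy r M.isKraus hρ b
  | loop r M S _ =>
    have h : ∀ b : Fin 2, IsPartialDensity (step B (.loop r M S) b ρ).2 :=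
      Fin.forall_fin_two.2 ⟨isPartialDensity_conjBy r M.isKraus hρ 0,
        isPartialDensity_conjBy r M.isKraus hρ 1⟩
    exact h b

theorem isPartialDensity_final {c : Config B} (hc : IsPartialDensity c.2) (n : ℕ)
    (p : TermPath B n c) : IsPartialDensity (p.final n c) :=
  final_induction isPartialDensity_step n c hc p

theorem pathSum_mono {q q' : Op B → ℝ≥0∞} (h : ∀ ρ, IsPartialDensity ρ → q ρ ≤ q' ρ)
    {c : Config B} (hc : IsPartialDensity c.2) : pathSum q c ≤ pathSum q' c :=
  pathSum_mono_of_final fun n p => h _ (isPartialDensity_final hc n p)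

theorem pathSum_congr {q q' : Op B → ℝ≥0∞} (h : ∀ ρ, IsPartialDensity ρ → q ρ = q' ρ)
    {c : Config B} (hc : IsPartialDensity c.2) : pathSum q c = pathSum q' c :=
  le_antisymm (pathSum_mono (fun ρ hρ => (h ρ hρ).le) hc)
    (pathSum_mono (fun ρ hρ => (h ρ hρ).ge) hc)

/-- `W` is the weakest precondition of `S` with respect to `Q`. -/
def IsWP (S : Prog typ) (Q W : QPred B) : Prop :=
  ∀ ρ, IsPartialDensity ρ → pathSum (val Q.1) (some S, ρ) = val W.1 ρ

/-- The weakest precondition of `I` is at most `I`, so the final states have total trace at most `1`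
and their sum converges. -/
theorem den_spec {S : Prog typ} (hS : ∀ Q : QPred B, ∃ W, IsWP S Q W) {ρ : Op B}
    (hρ : IsPartialDensity ρ) :
    IsPartialDensity (den B S ρ) ∧
      ∀ Q, 0 ≤ Q → val Q (den B S ρ) = pathSum (val Q) (some S, ρ) := by
  obtain ⟨W, hW⟩ := hS ⟨1, zero_le_one, le_rfl⟩
  exact tsum_states (fun p => (isPartialDensity_final (c := (some S, ρ)) hρ p.1 p.2).1)
    ((hW ρ hρ).trans_le (val_le_one W.2.1 W.2.2 hρ))

section Loop

variable {n : ℕ} (r : Fin n ↪ Var) (M : Measurement typ r (Fin 2))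

/-- The predicate `M₀† P M₀ + M₁† Q M₁`. -/
noncomputable def branchPred (P Q : QPred B) : QPred B :=
  ⟨star (cyl B r (M.op 0)) * P.1 * cyl B r (M.op 0) +
      star (cyl B r (M.op 1)) * Q.1 * cyl B r (M.op 1), by
    have h0 := star_left_conjugate_nonneg P.2.1 (cyl B r (M.op 0))
    have h1 := star_left_conjugate_nonneg Q.2.1 (cyl B r (M.op 1))
    refine ⟨add_nonneg h0 h1, (le_iff_expect (add_nonneg h0 h1) zero_le_one).2 fun ψ => ?_⟩
    rw [expect_add h0 h1, expect_conj, expect_conj, expect_one]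
    refine le_trans (add_le_add ?_ ?_) ((tsum_fin_two _).symm.trans_le
      (IsKraus.cyl (B := B) r M.isKraus ψ))
    · rw [← expect_one]
      exact expect_mono P.2.1 P.2.2 _
    · rw [← expect_one]
      exact expect_mono Q.2.1 Q.2.2 _⟩

theorem val_branchPred (P Q : QPred B) {ρ : Op B} (hρ : IsPartialDensity ρ) :
    val (branchPred r M P Q).1 ρ =
      val P.1 (conjBy B r (M.op 0) ρ) + val Q.1 (conjBy B r (M.op 1) ρ) := by
  have h0 := star_left_conjugate_nonneg P.2.1 (cyl B r (M.op 0))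
  have h1 := star_left_conjugate_nonneg Q.2.1 (cyl B r (M.op 1))
  rw [conjBy, conjBy, val_conj P.2.1 hρ.1, val_conj Q.2.1 hρ.1, ← val_add h0 h1]
  rfl

theorem val_loopStep {S : Prog typ} {g : QPred B → QPred B} (hg : ∀ Q, IsWP S Q (g Q))
    (P X : QPred B) {ρ : Op B} (hρ : IsPartialDensity ρ) :
    val (branchPred r M P (g X)).1 ρ = val P.1 (conjBy B r (M.op 0) ρ) +
      pathSum (val X.1) (some S, conjBy B r (M.op 1) ρ) := by
  rw [val_branchPred r M _ _ hρ, hg X _ (isPartialDensity_conjBy r M.isKraus hρ 1)]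

end Loop

end WeakestPreconditions

/-! ### The loop as a least fixed point, bound functions, and completeness. -/

section Completeness

variable {Var : Type} {typ : Var → QType} {B : GlobalBasis typ}

/-- The approximations from below of the weakest precondition of a loop, where `g` computes the
weakest preconditions of its body. -/
noncomputable def loopApprox {n : ℕ} (r : Fin n ↪ Var) (M : Measurement typ r (Fin 2))
    (g : QPred B → QPred B) (P : QPred B) : ℕ → QPred B
  | 0 => ⟨0, le_rfl, zero_le_one⟩
  | k + 1 => branchPred r M P (g (loopApprox r M g P k))

theorem loopApprox_le_succ {n : ℕ} (r : Fin n ↪ Var) (M : Measurement typ r (Fin 2))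
    {S : Prog typ} {g : QPred B → QPred B} (hg : ∀ Q, IsWP S Q (g Q)) (P : QPred B) (k : ℕ) :
    (loopApprox r M g P k).1 ≤ (loopApprox r M g P (k + 1)).1 := by
  induction k with
  | zero => exact (loopApprox r M g P 1).2.1
  | succ k ih =>
    refine le_of_val_le (loopApprox r M g P _).2.1 (loopApprox r M g P _).2.1 fun ρ hρ => ?_
    rw [loopApprox, loopApprox, val_loopStep r M hg P _ hρ, val_loopStep r M hg P _ hρ]
    exact add_le_add_right (pathSum_mono (c := (some S, conjBy B r (M.op 1) ρ))
      (fun σ _ => val_mono (loopApprox r M g P k).2.1 ih σ)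
      (isPartialDensity_conjBy r M.isKraus hρ 1)) _

/-- The supremum of `loopApprox` and its continuity properties. -/
theorem exists_loop_sup {n : ℕ} (r : Fin n ↪ Var) (M : Measurement typ r (Fin 2))
    {S : Prog typ} {g : QPred B → QPred B} (hg : ∀ Q, IsWP S Q (g Q)) (P : QPred B) :
    ∃ W : QPred B, (∀ ρ, val W.1 ρ = ⨆ k, val (loopApprox r M g P k).1 ρ) ∧
      ∀ c : Config B, pathSum (val W.1) c = ⨆ k, pathSum (val (loopApprox r M g P k).1) c := by
  obtain ⟨T, hT, hs, hf⟩ := exists_strong_limit (W := fun k => (loopApprox r M g P k).1) rfl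
    (fun k => (loopApprox r M g P k).2.2) (loopApprox_le_succ r M hg P)
  refine ⟨⟨T, hT⟩, fun ρ => ?_, fun c => ?_⟩
  · rw [hs, ENNReal.tsum_eq_iSup_nat]
    exact iSup_congr fun k => hf k ρ
  -- Continuity of `pathSum` along the approximations: the limit is a series of nonnegative
  -- increments, and two sums in `[0, ∞]` are exchanged.
  · rw [show val T = fun ρ => ∑' k, val ((loopApprox r M g P (k + 1)).1 -
      (loopApprox r M g P k).1) ρ from funext hs, pathSum_tsum, ENNReal.tsum_eq_iSup_nat]
    refine iSup_congr fun k => ?_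
    rw [← show (fun ρ => ∑ j ∈ Finset.range k, val ((loopApprox r M g P (j + 1)).1 -
      (loopApprox r M g P j).1) ρ) = val (loopApprox r M g P k).1 from funext (hf k)]
    exact (Summable.tsum_finsetSum fun _ _ => ENNReal.summable).symm

/-- The fixed point equation: by continuity the supremum can be taken through one round of the loop.
-/
theorem val_loop_sup {n : ℕ} {r : Fin n ↪ Var} {M : Measurement typ r (Fin 2)}
    {S : Prog typ} {g : QPred B → QPred B} (hg : ∀ Q, IsWP S Q (g Q)) {P W : QPred B}
    (hW : ∀ ρ, val W.1 ρ = ⨆ k, val (loopApprox r M g P k).1 ρ)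
    (hW' : ∀ c : Config B, pathSum (val W.1) c =
      ⨆ k, pathSum (val (loopApprox r M g P k).1) c) {ρ : Op B} (hρ : IsPartialDensity ρ) :
    val W.1 ρ = val P.1 (conjBy B r (M.op 0) ρ) +
      pathSum (val W.1) (some S, conjBy B r (M.op 1) ρ) := by
  rw [hW', ENNReal.add_iSup, hW]
  refine le_antisymm (iSup_mono fun k => ?_) (iSup_le fun k => ?_)
  · rw [← val_loopStep r M hg P _ hρ]
    exact val_mono (loopApprox r M g P k).2.1 (loopApprox_le_succ r M hg P k) ρ
  · rw [← val_loopStep r M hg P _ hρ]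
    exact le_iSup (fun k => val (loopApprox r M g P k).1 ρ) (k + 1)

/-- The fixed point equation bounds the computations of less than `k` steps by `W`, by induction on
`k`. Conversely, unfolding the loop shows inductively that each approximation is below the sum over
all computations. -/
theorem isWP_loop_sup {n : ℕ} {r : Fin n ↪ Var} {M : Measurement typ r (Fin 2)}
    {S : Prog typ} {g : QPred B → QPred B} (hg : ∀ Q, IsWP S Q (g Q)) {P W : QPred B}
    (hW : ∀ ρ, val W.1 ρ = ⨆ k, val (loopApprox r M g P k).1 ρ)
    (hW' : ∀ c : Config B, pathSum (val W.1) c =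
      ⨆ k, pathSum (val (loopApprox r M g P k).1) c) : IsWP (.loop r M S) P W := by
  intro ρ hρ
  refine le_antisymm (pathSum_le fun k => ?_) ?_
  · induction k generalizing ρ with
    | zero => exact zero_le
    | succ k ih =>
      rw [val_loop_sup hg hW hW' hρ]
      exact (pathSumLT_succ_loop_le _ r M S k ρ).trans (add_le_add_right
        (pathSum_mono (c := (some S, conjBy B r (M.op 1) ρ)) ih (isPartialDensity_conjBy r M.isKraus hρ 1)) _)
  · rw [hW]
    refine iSup_le fun k => ?_
    induction k generalizing ρ with
    | zero => exact (val_zero ρ).trans_le zero_le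
    | succ k ih =>
      rw [loopApprox, val_loopStep r M hg P _ hρ, pathSum_loop]
      exact add_le_add_right (pathSum_mono (c := (some S, conjBy B r (M.op 1) ρ)) ih
        (isPartialDensity_conjBy r M.isKraus hρ 1)) _

/-- If the quantity `w` decreases along `F` and tends to zero, then the time until it gets smaller
than `e` is a bound function. -/
theorem exists_ranking {α : Type*} {I : α → Prop} {F : α → α} (hF : ∀ x, I x → I (F x))
    {w : α → ℝ≥0∞} (hw : ∀ x, I x → w (F x) ≤ w x) {e : ℝ≥0∞}
    (he : ∀ x, I x → ∃ n, w (F^[n] x) < e) :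
    ∃ t : α → ℕ, ∀ x, I x → t (F x) ≤ t x ∧ (e ≤ w (F x) → t (F x) < t x) := by
  have hI : ∀ n x, I x → I (F^[n] x) := fun n => by
    induction n with
    | zero => exact fun x hx => hx
    | succ n ih => exact fun x hx => ih _ (hF x hx)
  have hsucc : ∀ n x, I x → w (F^[n + 1] x) ≤ w (F^[n] x) := fun n x hx => by
    rw [Function.iterate_succ_apply']
    exact hw _ (hI n x hx)
  -- The exponent is `n + 1` because strict decrease is demanded when `w (F x)`, not `w x`, is at
  -- least `e`; thus `t x = 0` forces `w (F x) < e`.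
  refine ⟨fun x => sInf {n | w (F^[n + 1] x) < e}, fun x hx => ?_⟩
  have hmem : sInf {n | w (F^[n + 1] x) < e} ∈ {n | w (F^[n + 1] x) < e} := by
    obtain ⟨n, hn⟩ := he x hx
    exact Nat.sInf_mem ⟨n, (hsucc n x hx).trans_lt hn⟩
  refine ⟨Nat.sInf_le ((hsucc _ x hx).trans_lt hmem), fun h => ?_⟩
  dsimp only
  cases hn : sInf {n | w (F^[n + 1] x) < e} with
  | zero =>
    rw [hn] at hmem
    exact absurd hmem h.not_gt
  | succ m =>
    rw [hn] at hmem
    exact Nat.lt_succ_of_le (Nat.sInf_le hmem)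

theorem exists_boundFunction {n : ℕ} {r : Fin n ↪ Var} {M : Measurement typ r (Fin 2)}
    {S : Prog typ} {g : QPred B → QPred B} (hg : ∀ Q, IsWP S Q (g Q)) {P W : QPred B}
    (hW : ∀ ρ, val W.1 ρ = ⨆ k, val (loopApprox r M g P k).1 ρ)
    (hW' : ∀ c : Config B, pathSum (val W.1) c =
      ⨆ k, pathSum (val (loopApprox r M g P k).1) c) {ε : ℝ} (hε : 0 < ε) :
    ∃ t : Op B → ℕ, IsBoundFunction
      (star (cyl B r (M.op 1)) * (g W).1 * cyl B r (M.op 1)) ε r M S t := by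
  set F : Op B → Op B := fun ρ => den B S (conjBy B r (M.op 1) ρ) with hFdef
  have hspec : ∀ ρ, IsPartialDensity ρ → IsPartialDensity (F ρ) ∧ ∀ Q, 0 ≤ Q →
      val Q (F ρ) = pathSum (val Q) (some S, conjBy B r (M.op 1) ρ) := fun ρ hρ =>
    den_spec (fun Q => ⟨g Q, hg Q⟩) (isPartialDensity_conjBy r M.isKraus hρ 1)
  have hrec : ∀ ρ, IsPartialDensity ρ →
      val W.1 ρ = val P.1 (conjBy B r (M.op 0) ρ) + val W.1 (F ρ) := fun ρ hρ => by
    rw [(hspec ρ hρ).2 _ W.2.1, ← val_loop_sup hg hW hW' hρ]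
  have hiter : ∀ k ρ, IsPartialDensity ρ →
      val W.1 ρ = val (loopApprox r M g P k).1 ρ + val W.1 (F^[k] ρ) := by
    intro k
    induction k with
    | zero => exact fun ρ _ => by rw [loopApprox, val_zero, zero_add]; rfl
    | succ k ih =>
      intro ρ hρ
      rw [loopApprox, val_loopStep r M hg P _ hρ, hrec ρ hρ, ih _ (hspec ρ hρ).1,
        (hspec ρ hρ).2 _ (loopApprox r M g P k).2.1, add_assoc]
      rfl
  have hlt : ∀ ρ, IsPartialDensity ρ → ∃ k, val W.1 (F^[k] ρ) < ENNReal.ofReal ε := by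
    intro ρ hρ
    by_contra! h
    -- If `W` stayed at least `ε` along the orbit, every `Wₖ` would fall short of `W` by `ε` at `ρ`,
    -- and so would their supremum, which is `W`.
    have h1 : val W.1 ρ + ENNReal.ofReal ε ≤ val W.1 ρ := by
      conv_lhs => rw [hW, ENNReal.iSup_add]
      refine iSup_le fun k => ?_
      rw [hiter k ρ hρ]
      exact add_le_add_right (h k) _
    have h2 : val W.1 ρ ≠ ∞ := ((val_le_one W.2.1 W.2.2 hρ).trans_lt ENNReal.one_lt_top).ne
    exact (ENNReal.lt_add_right h2 (ENNReal.ofReal_pos.2 hε).ne').not_ge h1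
  obtain ⟨t, ht⟩ := exists_ranking (I := IsPartialDensity) (fun ρ hρ => (hspec ρ hρ).1)
    (fun ρ hρ => (hrec ρ hρ).symm ▸ le_add_self) hlt
  refine ⟨t, fun ρ hρ => ⟨(ht ρ hρ).1, fun h => (ht ρ hρ).2 ?_⟩⟩
  -- The quantity in the side condition of the rule, `tr (M₁† wp(S, W) M₁ ρ)`, is the value of `W`
  -- after one round.
  rw [(hspec ρ hρ).2 _ W.2.1, hg W _ (isPartialDensity_conjBy r M.isKraus hρ 1), conjBy,
    val_conj (g W).2.1 hρ.1,
    ← (ofReal_tr_mul (star_left_conjugate_nonneg (g W).2.1 (cyl B r (M.op 1))) hρ).2]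
  exact ENNReal.ofReal_le_ofReal h

/-- Since states separate predicates, the fixed point equation holds between operators. Hence `W` is
both the postcondition required of the body and the precondition concluded by the loop rule. -/
theorem exists_provable_isWP_loop {n : ℕ} (r : Fin n ↪ Var) (M : Measurement typ r (Fin 2))
    {S : Prog typ} (hS : ∀ Q : QPred B, ∃ W, ProvableTD W S Q ∧ IsWP S Q W) (P : QPred B) :
    ∃ W, ProvableTD W (.loop r M S) P ∧ IsWP (.loop r M S) P W := by
  choose g hp hg using hS
  obtain ⟨W, hW, hW'⟩ := exists_loop_sup r M hg P
  have h : ∀ ρ, IsPartialDensity ρ → val W.1 ρ = val (branchPred r M P (g W)).1 ρ :=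
    fun ρ hρ => by rw [val_loopStep r M hg P W hρ, val_loop_sup hg hW hW' hρ]
  have hfix : W.1 = (branchPred r M P (g W)).1 :=
    le_antisymm (le_of_val_le W.2.1 (branchPred r M P (g W)).2.1 fun ρ hρ => (h ρ hρ).le)
      (le_of_val_le (branchPred r M P (g W)).2.1 W.2.1 fun ρ hρ => (h ρ hρ).ge)
  exact ⟨W, .loop r M S P (g W) W hfix (hp W) fun ε hε => exists_boundFunction hg hW hW' hε,
    isWP_loop_sup hg hW hW'⟩

/-- Every program has weakest preconditions, and they are provable. -/
theorem exists_provable_isWP (S : Prog typ) (Q : QPred B) :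
    ∃ W, ProvableTD W S Q ∧ IsWP S Q W := by
  induction S generalizing Q with
  | skip => exact ⟨Q, .skip Q, fun ρ _ => pathSum_skip _ ρ⟩
  | init q =>
    obtain ⟨T, hT, hs⟩ := (isKraus_ketbraVar (B := B) q).exists_strongSum
      (P := fun _ => Q.1) fun _ => Q.2
    refine ⟨⟨T, hT⟩, .init q Q ⟨T, hT⟩ ?_, fun ρ hρ => ?_⟩
    · simpa only [star_ketbraVar] using hs
    · rw [pathSum_init, (initState_spec q hρ).2 _ Q.2.1]
      exact (IsKraus.val_eq_tsum (fun _ => Q.2.1) hs hρ.1).symm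
  | unitary r U hU =>
    obtain ⟨T, hT, hs⟩ := (IsKraus.cyl (B := B) r (isKraus_of_isometry hU)).exists_strongSum
      (P := fun _ => Q.1) fun _ => Q.2
    -- The one-element Kraus family supplies the bounds `0 ⊑ T ⊑ I`; its strong sum is its only
    -- term.
    have h : T = star (cyl B r U) * Q.1 * cyl B r U :=
      ContinuousLinearMap.ext fun ψ => (hs ψ).unique (hasSum_unique _)
    refine ⟨⟨T, hT⟩, .unitary r U hU Q ⟨T, hT⟩ h, fun ρ hρ => ?_⟩
    rw [pathSum_unitary, conjBy, val_conj Q.2.1 hρ.1, ← h]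
  | seq S₁ S₂ ih₁ ih₂ =>
    obtain ⟨W₂, hp₂, hW₂⟩ := ih₂ Q
    obtain ⟨W₁, hp₁, hW₁⟩ := ih₁ W₂
    refine ⟨W₁, .seq S₁ S₂ W₁ W₂ Q hp₁ hp₂, fun ρ hρ => ?_⟩
    rw [pathSum_seq, pathSum_congr (c := (some S₁, ρ)) hW₂ hρ, hW₁ ρ hρ]
  | measure r M S ih =>
    choose W hp hW using fun m => ih m Q
    obtain ⟨T, hT, hs⟩ := (IsKraus.cyl (B := B) r M.isKraus).exists_strongSum
      (P := fun m => (W m).1) fun m => (W m).2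
    refine ⟨⟨T, hT⟩, .measure r M S W ⟨T, hT⟩ Q hp hs, fun ρ hρ => ?_⟩
    rw [pathSum_measure, IsKraus.val_eq_tsum (fun m => (W m).2.1) hs hρ.1]
    exact tsum_congr fun m => hW m _ (isPartialDensity_conjBy r M.isKraus hρ m)
  | loop r M S ih => exact exists_provable_isWP_loop r M ih Q

end Completeness

end QHoare

theorem mainTheorem2 {Var : Type} [Countable Var] [Infinite Var] (typ : Var → QHoare.QType)
    (B : QHoare.GlobalBasis typ) (S : QHoare.Prog typ) (P Q : QHoare.QPred B)
    (h : QHoare.ModelsTot P S Q) : QHoare.ProvableTD P S Q := by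
  obtain ⟨W, hp, hW⟩ := QHoare.exists_provable_isWP S Q
  -- Truth of the triple says that `P` is below the weakest precondition on every state.
  refine .order S P W Q Q (QHoare.le_of_val_le P.2.1 W.2.1 fun ρ hρ => ?_) hp le_rfl
  obtain ⟨hd, hv⟩ := QHoare.den_spec
    (fun R => (QHoare.exists_provable_isWP S R).imp fun _ => And.right) hρ
  rw [← hW ρ hρ, ← hv Q.1 Q.2.1, ← (QHoare.ofReal_tr_mul P.2.1 hρ).2,
    ← (QHoare.ofReal_tr_mul Q.2.1 hd).2]
  exact ENNReal.ofReal_le_ofReal (h ρ hρ)
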